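/- **Lemma (Bifurcation points).** Let $g>0$, $L>0$ and $\alpha\in(0,1)$. Let $\gamma\in C^{1+\alpha}([0,\infty))$ (that is, $\gamma$ is $C^1$ on $[0,\infty)$, $\gamma$ and $\gamma'$ are bounded, and $\gamma'$ is $\alpha$-Hölder continuous on $[0,\infty)$). Put $$\Gamma(p)=\int_0^p\gamma(-p')\,dp'\quad(p\le 0),\qquad \Gamma_{\inf}=\inf_{p\le 0}\Gamma(p),\qquad a(p;\lambda)=(\lambda+2\Gamma(p))^{1/2}\quad(\lambda>-2\Gamma_{\inf}),$$ and assume that $\Gamma$ is bounded on $(-\infty,0]$ and that $$\int_{-\infty}^0\Big(2\,(2\Gamma(p)-2\Gamma_{\inf})^{3/2}+\Big(\frac{\pi}{L}\Big)^2(2\Gamma(p)-2\Gamma_{\inf})^{1/2}\Big)e^{2p}\,dp<g .$$ Let $X$ be the space of functions $\varphi(q,p)$, $q\in\mathbb R$, $p\le 0$, that are even and $2L$-periodic in $q$, belong to the Hölder class $C^{3+\alpha}$ up to the boundary $p=0$ (all partial derivatives of order at most $3$ are continuous and bounded, and those of order $3$ are $\alpha$-Hölder continuous), and whose partial derivatives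 of order at most $3$ all tend to $0$ as $p\to-\infty$, uniformly in $q$. For $\varepsilon\ge 0$ and $\lambda>-2\Gamma_{\inf}$ consider the linear problem for $\varphi\in X$ $$(a^3\varphi_p)_p+(a\,\varphi_q)_q-\varepsilon a^3\varphi=0\ \text{ for } -L<q<L,\ p<0,\qquad \lambda^{3/2}\varphi_p=g\varphi\ \text{ for } -L<q<L,\ p=0,\tag{1}$$ where $a=a(p;\lambda)$. (i) For each $0\le\varepsilon<1$ there is a unique $\lambda^\varepsilon\in(-2\Gamma_{\inf},\,gL/\pi-2\Gamma_{\inf}]$ such that (1) with $\lambda=\lambda^\varepsilon$ has a nontrivial solution in $X$ of the form $v(p)\cos(\pi q/L)$. At $\lambda=\lambda^\varepsilon$ there is a solution $\Phi^\varepsilon(p)\cos(\pi q/L)\in X$ of (1) with $\Phi^\varepsilon(p)>0$ for all $p\le 0$ and $|\Phi^\varepsilon(p)|\le Ke^{\sigma p}$ for all $p\le0$, for some constants $K$ and $\sigma>0$; and every solution $\varphi\in X$ of (1) at $\lambda=\lambda^\varepsilon$ is a constant multiple of it. (ii) $\lambda^\varepsilon\le\lambda^0$ for each $0\le\varepsilon<1$,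 and $\lambda^\varepsilon\to\lambda^0$ as $\varepsilon\to0+$. -/

import Mathlib

open Real Set Filter Topology MeasureTheory

namespace StokesWave

noncomputable section

/-! ### The vorticity function and its primitive -/

/-- `γ ∈ C^{1+α}([0,∞))`: `γ` is continuously differentiable on `[0,∞)` (one-sided at `0`),
`γ` and `γ'` are bounded, and `γ'` is globally Hölder continuous with exponent `α`.
Only the values of `γ` on `[0,∞)` matter. -/
structure HolderC1 (α : ℝ) (γ : ℝ → ℝ) : Prop where
  contDiffOn : ContDiffOn ℝ 1 γ (Ici 0)
  bounded : ∃ C : ℝ, ∀ r, 0 ≤ r → |γ r| ≤ C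
  bounded_deriv : ∃ C : ℝ, ∀ r, 0 ≤ r → |derivWithin γ (Ici 0) r| ≤ C
  holder_deriv : ∃ C : ℝ, ∀ r s, 0 ≤ r → 0 ≤ s →
    |derivWithin γ (Ici 0) r - derivWithin γ (Ici 0) s| ≤ C * |r - s| ^ α

/-- `Γ(p) = ∫₀ᵖ γ(-p') dp'`, used for `p ≤ 0`. -/
def Gam (γ : ℝ → ℝ) (p : ℝ) : ℝ := ∫ s in (0 : ℝ)..p, γ (-s)

/-- `Γ_inf = inf_{p ≤ 0} Γ(p)`. -/
def GamInf (γ : ℝ → ℝ) : ℝ := sInf (Gam γ '' Iic 0)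

/-- `Γ` is bounded on `(-∞,0]`. -/
def GamBounded (γ : ℝ → ℝ) : Prop := ∃ M : ℝ, ∀ p, p ≤ 0 → |Gam γ p| ≤ M

/-- The integral condition that ensures local bifurcation. -/
def BifurcationCondition (g L : ℝ) (γ : ℝ → ℝ) : Prop :=
  ∫ p in Iic (0 : ℝ),
      (2 * (2 * Gam γ p - 2 * GamInf γ) ^ (3 / 2 : ℝ)
        + (π / L) ^ 2 * (2 * Gam γ p - 2 * GamInf γ) ^ (1 / 2 : ℝ)) * exp (2 * p) < g

/-- `a(p; lam) = (lam + 2 Γ(p))^{1/2}`. -/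
def aCoef (γ : ℝ → ℝ) (lam p : ℝ) : ℝ := √(lam + 2 * Gam γ p)

/-! ### Functions `φ(q,p)` on the half plane `{p ≤ 0}` -/

/-- `∂φ/∂q`. -/
def partialQ (φ : ℝ → ℝ → ℝ) (q p : ℝ) : ℝ := deriv (fun x => φ x p) q

/-- `∂φ/∂p` on `{p ≤ 0}` (one-sided at `p = 0`). -/
def partialP (φ : ℝ → ℝ → ℝ) (q p : ℝ) : ℝ := derivWithin (fun s => φ q s) (Iic 0) p

/-- `∂_p^{k₂} ∂_q^{k₁} φ`. -/
def mixedPartial (k₁ k₂ : ℕ) (φ : ℝ → ℝ → ℝ) : ℝ → ℝ → ℝ :=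
  partialP^[k₂] (partialQ^[k₁] φ)

/-- The Hölder space `C^{k+α}_per` of functions on `{p ≤ 0}` that are even and `2L`-periodic in `q`:
`φ` is `C^k` up to the boundary, all partial derivatives of order at most `k` are bounded, and those
of order `k` are Hölder continuous with exponent `α`. For such even periodic functions the bounds
over the half plane are the same as those over the closed strip `{|q| ≤ L, p ≤ 0}`. -/
structure HolderPer (L α : ℝ) (k : ℕ) (φ : ℝ → ℝ → ℝ) : Prop where
  contDiffOn : ContDiffOn ℝ k (fun z : ℝ × ℝ => φ z.1 z.2) (univ ×ˢ Iic 0)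
  even : ∀ q p, p ≤ 0 → φ (-q) p = φ q p
  periodic : ∀ q p, p ≤ 0 → φ (q + 2 * L) p = φ q p
  bounded : ∀ k₁ k₂, k₁ + k₂ ≤ k → ∃ C : ℝ, ∀ q p, p ≤ 0 → |mixedPartial k₁ k₂ φ q p| ≤ C
  holder : ∀ k₁ k₂, k₁ + k₂ = k → ∃ C : ℝ, ∀ q p q' p', p ≤ 0 → p' ≤ 0 →
    |mixedPartial k₁ k₂ φ q p - mixedPartial k₁ k₂ φ q' p'|
      ≤ C * ((q - q') ^ 2 + (p - p') ^ 2) ^ (α / 2)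

/-- The space `X`: functions in `C^{3+α}_per` all of whose partial derivatives of order at most `3`
tend to `0` as `p → -∞`, uniformly in `q`. -/
structure MemX (L α : ℝ) (φ : ℝ → ℝ → ℝ) : Prop where
  holderPer : HolderPer L α 3 φ
  decay : ∀ k₁ k₂, k₁ + k₂ ≤ 3 →
    TendstoUniformly (fun p q => mixedPartial k₁ k₂ φ q p) (fun _ => 0) atBot

/-! ### The linearized problem -/

/-- `φ ∈ X` solves `(a³ φ_p)_p + (a φ_q)_q - ε a³ φ = 0` in `R = (-L,L) × (-∞,0)` and
`lam^{3/2} φ_p = g φ` on `T = (-L,L) × {0}`, where `a = a(·; lam)`. -/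
structure IsEigenSolution (g L α : ℝ) (γ : ℝ → ℝ) (ε lam : ℝ) (φ : ℝ → ℝ → ℝ) : Prop where
  memX : MemX L α φ
  interior : ∀ q p, -L < q → q < L → p < 0 →
    partialP (fun x s => aCoef γ lam s ^ 3 * partialP φ x s) q p
      + partialQ (fun x s => aCoef γ lam s * partialQ φ x s) q p
      - ε * aCoef γ lam p ^ 3 * φ q p = 0
  boundary : ∀ q, -L < q → q < L → lam ^ (3 / 2 : ℝ) * partialP φ q 0 = g * φ q 0

/-- `φ` does not vanish identically on `{p ≤ 0}`. -/
def Nontrivial (φ : ℝ → ℝ → ℝ) : Prop := ∃ q p, p ≤ 0 ∧ φ q p ≠ 0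

/-- The function `v(p) cos(πq/L)`. -/
def firstMode (L : ℝ) (v : ℝ → ℝ) : ℝ → ℝ → ℝ := fun q p => v p * cos (π * q / L)

end

end StokesWave

/-!
A Fourier mode `v(p) cos(kπq/L)` solves the linearized problem when
`(a³ v')' = (κ a + ε a³) v` with `κ = (kπ/L)²` and `a³ v' = g v` at `p = 0` (recall `Γ(0) = 0`).
For a positive solution decaying at `-∞`, the quantity `w = a³ v' / v` is a bounded, uniformly
positive solution of the Riccati equation `w' = κ a + ε a³ - w² / a³`, and the boundary condition
reads `w(0) = g`. After the coefficients are extended by constants to `p > 0`, such a `w` is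
obtained on the whole line by a contraction argument (`exists_isRiccati`). A maximum principle at
`-∞` (`nonpos_of_deriv_le`) gives comparison of Riccati solutions, so that `w(0)` is strictly
increasing in `lam` and in `κ`, nondecreasing in `ε`, and continuous in the parameters.

Testing with `e^p` bounds `w(0)` by `∫ (a³ + κ a + ε a³) e^{2p}` (`IsRiccati.le_integral`), which
the bifurcation condition keeps below `g` for `lam` near `-2 Γ_inf`; at the right end of the
interval the constant `g` is a subsolution, hence `w(0) ≥ g`. The intermediate value theorem and
monotonicity determine `lam^ε` as the only solution of `w(0) = g` with `κ = (π/L)²`, and part (ii)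
follows from monotonicity and continuity in `ε`.

The eigenfunction is `exp ∫₀ᵖ w / a³`. Its derivatives up to order three are bounded multiples of
it and inherit the Hölder continuity of `γ'` (`memX_modeFun`). Conversely, for the `k`-th cosine
coefficient `v` of an arbitrary solution, `z = a³ v' - w v` is bounded with `z' = -(w / a³) z`, so
`z = 0` and `(w(0) - g) v(0) = 0` (`IsEigenSolution.cosCoeff_eq`). Strict monotonicity in `κ`
excludes all modes but the first; only the mean for `ε = 0`, where there is no positive `w`, is
treated separately, by decay at `-∞`. Uniqueness of Fourier series finishes the proof.
-/

namespace StokesWave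

/-! ### Bounded solutions on a half line -/

/-- Maximum principle at `-∞`: a function bounded above whose derivative is at most `-h D`, with
`h` bounded below by a positive constant, would grow exponentially backwards from any point
where it is positive. -/
lemma nonpos_of_deriv_le {D D' h : ℝ → ℝ} {h₀ B : ℝ} (hc : ContinuousOn D (Iic 0))
    (hd : ∀ p < 0, HasDerivAt D (D' p) p) (hh : Continuous h) (hpos : 0 < h₀)
    (hle : ∀ p, h₀ ≤ h p) (hineq : ∀ p < 0, D' p ≤ -(h p * D p))
    (hB : ∀ p ≤ 0, D p ≤ B) : ∀ p ≤ 0, D p ≤ 0 := by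
  intro p₀ hp₀
  by_contra! hD
  have hHd : ∀ p, HasDerivAt (fun p => ∫ s in (0 : ℝ)..p, h s) (h p) p := fun p =>
    intervalIntegral.integral_hasDerivAt_right (hh.intervalIntegrable _ _)
      (hh.stronglyMeasurableAtFilter _ _) hh.continuousAt
  set H : ℝ → ℝ := fun p => ∫ s in (0 : ℝ)..p, h s with hH
  have hHc : Continuous H := continuous_iff_continuousAt.2 fun p => (hHd p).continuousAt
  have hEd : ∀ p < 0, HasDerivAt (fun p => D p * exp (H p))
      (D' p * exp (H p) + D p * (exp (H p) * h p)) p := fun p hp =>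
    (hd p hp).mul (hHd p).exp
  have hanti : AntitoneOn (fun p => D p * exp (H p)) (Iic 0) := by
    refine antitoneOn_of_deriv_nonpos (convex_Iic 0)
      (hc.mul (Real.continuous_exp.comp hHc).continuousOn) ?_ ?_
    · intro p hp
      rw [interior_Iic] at hp
      exact (hEd p hp).differentiableAt.differentiableWithinAt
    · intro p hp
      rw [interior_Iic] at hp
      rw [(hEd p hp).deriv]
      have := mul_le_mul_of_nonneg_right (hineq p hp) (exp_pos (H p)).le
      nlinarith
  have hBpos : 0 < B := hD.trans_le (hB p₀ hp₀)
  -- going back by `B / (h₀ D p₀)` is enough to exceed the bound `B`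
  set t : ℝ := B / D p₀ / h₀ with ht
  have htpos : 0 < t := by positivity
  have hth : h₀ * t = B / D p₀ := by rw [ht]; field_simp
  have h1 := hanti (show p₀ - t ∈ Iic (0 : ℝ) by simp only [mem_Iic]; linarith)
    (show p₀ ∈ Iic (0 : ℝ) from hp₀) (by linarith)
  have h2 : h₀ * t ≤ H p₀ - H (p₀ - t) := by
    have : H p₀ - H (p₀ - t) = ∫ s in (p₀ - t)..p₀, h s := by
      simp only [hH]
      exact intervalIntegral.integral_interval_sub_left (hh.intervalIntegrable _ _)
        (hh.intervalIntegrable _ _)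
    rw [this]
    have h3 := intervalIntegral.integral_mono_on (μ := volume) (a := p₀ - t) (b := p₀) (by linarith)
      (f := fun _ => h₀) (g := h) (by simp) (hh.intervalIntegrable _ _) (fun p _ => hle p)
    rw [intervalIntegral.integral_const, smul_eq_mul] at h3
    linarith
  have h4 : D p₀ * exp (H p₀ - H (p₀ - t)) ≤ D (p₀ - t) := by
    rw [exp_sub, mul_div_assoc', div_le_iff₀ (exp_pos _)]
    exact h1
  have h5 := hB (p₀ - t) (by linarith)
  have h6 : D p₀ * (B / D p₀ + 1) ≤ D p₀ * exp (H p₀ - H (p₀ - t)) := by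
    gcongr
    linarith [add_one_le_exp (H p₀ - H (p₀ - t))]
  have h7 : D p₀ * (B / D p₀ + 1) = B + D p₀ := by field_simp
  linarith

/-- A bounded solution of `w' = -c w + f(p, w)` on the whole line, obtained as the fixed point of
`w ↦ ∫_{-∞}^p e^{-c(p-s)} f(s, w(s)) ds`; it inherits the bounds of `f / c`. -/
lemma exists_bounded_solution {f : ℝ → ℝ → ℝ} (hf : Continuous (Function.uncurry f))
    {c k m M : ℝ} (hc : 0 < c) (hk : 0 ≤ k) (hkc : k < c)
    (hlip : ∀ s x y, |f s x - f s y| ≤ k * |x - y|)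
    (hm : ∀ s x, c * m ≤ f s x) (hM : ∀ s x, f s x ≤ c * M) :
    ∃ w : ℝ → ℝ, (∀ p, HasDerivAt w (f p (w p) - c * w p) p) ∧ ∀ p, m ≤ w p ∧ w p ≤ M := by
  have hexpI : ∀ p, IntegrableOn (fun s => exp (c * s)) (Iic p) := fun p =>
    integrableOn_exp_mul_Iic hc p
  have hexpV : ∀ p, ∫ s in Iic p, exp (c * s) = exp (c * p) / c := fun p =>
    integral_exp_mul_Iic hc p
  have hcont : ∀ w : ℝ → ℝ, Continuous w → Continuous fun s => exp (c * s) * f s (w s) :=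
    fun w hw => by
      have : Continuous fun s => f s (w s) := hf.comp (continuous_id.prodMk hw)
      fun_prop
  have hbd : ∀ s x, |f s x| ≤ |c * m| + |c * M| := fun s x => by
    have h1 := hm s x
    have h2 := hM s x
    rw [abs_le]
    constructor
    · linarith [neg_abs_le (c * m), abs_nonneg (c * M)]
    · linarith [le_abs_self (c * M), abs_nonneg (c * m)]
  have hint : ∀ w : ℝ → ℝ, Continuous w → ∀ p,
      IntegrableOn (fun s => exp (c * s) * f s (w s)) (Iic p) := fun w hw p => by
    refine Integrable.mono' ((hexpI p).mul_const (|c * m| + |c * M|))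
      (hcont w hw).aestronglyMeasurable (ae_of_all _ fun s => ?_)
    rw [norm_mul, Real.norm_eq_abs, Real.norm_eq_abs, abs_of_pos (exp_pos _)]
    exact mul_le_mul_of_nonneg_left (hbd _ _) (exp_pos _).le
  let T : (ℝ → ℝ) → ℝ → ℝ := fun w p =>
    exp (-(c * p)) * ∫ s in Iic p, exp (c * s) * f s (w s)
  have hTd : ∀ w : ℝ → ℝ, Continuous w → ∀ p, HasDerivAt (T w) (f p (w p) - c * T w p) p := by
    intro w hw p
    have h1 : HasDerivAt (fun p => ∫ s in Iic p, exp (c * s) * f s (w s))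
        (exp (c * p) * f p (w p)) p := by
      have h2 : (fun p => ∫ s in Iic p, exp (c * s) * f s (w s)) = fun p =>
          (∫ s in Iic (0 : ℝ), exp (c * s) * f s (w s))
            + ∫ s in (0 : ℝ)..p, exp (c * s) * f s (w s) := by
        funext p
        rw [← intervalIntegral.integral_Iic_sub_Iic (hint w hw 0) (hint w hw p)]
        ring
      rw [h2]
      exact (intervalIntegral.integral_hasDerivAt_right ((hcont w hw).intervalIntegrable _ _)
        ((hcont w hw).stronglyMeasurableAtFilter _ _) (hcont w hw).continuousAt).const_add _
    have h3 : HasDerivAt (fun p => exp (-(c * p))) (exp (-(c * p)) * (-(c * 1))) p :=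
      (((hasDerivAt_id p).const_mul c).neg).exp
    have h4 : exp (-(c * p)) * exp (c * p) = 1 := by rw [← exp_add]; simp
    refine (h3.mul h1).congr_deriv ?_
    simp only [T]
    linear_combination (f p (w p)) * h4
  have hTb : ∀ w : ℝ → ℝ, Continuous w → ∀ p, m ≤ T w p ∧ T w p ≤ M := by
    intro w hw p
    have h4 : exp (-(c * p)) * (exp (c * p) / c) = 1 / c := by
      rw [mul_div_assoc', ← exp_add]; simp
    constructor
    · have : ∫ s in Iic p, exp (c * s) * (c * m) ≤ ∫ s in Iic p, exp (c * s) * f s (w s) :=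
        setIntegral_mono ((hexpI p).mul_const _) (hint w hw p) fun s =>
          mul_le_mul_of_nonneg_left (hm _ _) (exp_pos _).le
      rw [integral_mul_const, hexpV] at this
      have := mul_le_mul_of_nonneg_left this (exp_pos (-(c * p))).le
      rw [← mul_assoc, h4] at this
      simpa [T, hc.ne'] using this
    · have : ∫ s in Iic p, exp (c * s) * f s (w s) ≤ ∫ s in Iic p, exp (c * s) * (c * M) :=
        setIntegral_mono (hint w hw p) ((hexpI p).mul_const _) fun s =>
          mul_le_mul_of_nonneg_left (hM _ _) (exp_pos _).le
      rw [integral_mul_const, hexpV] at this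
      have := mul_le_mul_of_nonneg_left this (exp_pos (-(c * p))).le
      rw [← mul_assoc (exp _) (_ / _), h4] at this
      simpa [T, hc.ne'] using this
  have hTc : ∀ w : ℝ → ℝ, Continuous w → Continuous (T w) := fun w hw =>
    continuous_iff_continuousAt.2 fun p => (hTd w hw p).continuousAt
  let S : BoundedContinuousFunction ℝ ℝ → BoundedContinuousFunction ℝ ℝ := fun w =>
    BoundedContinuousFunction.ofNormedAddCommGroup (T w) (hTc w w.continuous) (|m| + |M|)
      fun p => by
        obtain ⟨h1, h2⟩ := hTb w w.continuous p
        rw [Real.norm_eq_abs, abs_le]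
        constructor
        · linarith [neg_abs_le m, abs_nonneg M]
        · linarith [le_abs_self M, abs_nonneg m]
  have hS : ContractingWith (Real.toNNReal (k / c)) S := by
    refine ⟨?_, LipschitzWith.of_dist_le_mul fun u v => ?_⟩
    · rw [Real.toNNReal_lt_one]
      exact (div_lt_one hc).2 hkc
    · rw [Real.coe_toNNReal _ (by positivity), BoundedContinuousFunction.dist_le (by positivity)]
      intro p
      change |T u p - T v p| ≤ k / c * dist u v
      have h1 : T u p - T v p
          = exp (-(c * p)) * ∫ s in Iic p, exp (c * s) * (f s (u s) - f s (v s)) := by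
        simp only [T, mul_sub]
        rw [integral_sub (hint u u.continuous p) (hint v v.continuous p), mul_sub]
      rw [h1, abs_mul, abs_of_pos (exp_pos _)]
      have h2 : |∫ s in Iic p, exp (c * s) * (f s (u s) - f s (v s))|
          ≤ ∫ s in Iic p, exp (c * s) * (k * dist u v) := by
        rw [← Real.norm_eq_abs]
        refine norm_integral_le_of_norm_le ((hexpI p).mul_const _) (ae_of_all _ fun s => ?_)
        rw [norm_mul, Real.norm_eq_abs, Real.norm_eq_abs, abs_of_pos (exp_pos _)]
        refine mul_le_mul_of_nonneg_left ((hlip _ _ _).trans ?_) (exp_pos _).le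
        have h3 : dist (u s) (v s) ≤ dist u v := BoundedContinuousFunction.dist_coe_le_dist s
        rw [Real.dist_eq] at h3
        exact mul_le_mul_of_nonneg_left h3 hk
      rw [integral_mul_const, hexpV] at h2
      refine (mul_le_mul_of_nonneg_left h2 (exp_pos _).le).trans_eq ?_
      have h4 : exp (-(c * p)) * exp (c * p) = 1 := by rw [← exp_add]; simp
      field_simp
      linear_combination (k * dist u v) * h4
  have hfix : S (ContractingWith.fixedPoint S hS) = ContractingWith.fixedPoint S hS :=
    hS.fixedPoint_isFixedPt
  set w := ContractingWith.fixedPoint S hS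
  have hTw : T w = w := congrArg (fun u : BoundedContinuousFunction ℝ ℝ => (u : ℝ → ℝ)) hfix
  refine ⟨w, fun p => ?_, fun p => ?_⟩
  · have := hTd w w.continuous p
    rwa [hTw] at this
  · have := hTb w w.continuous p
    rwa [hTw] at this

/-! ### The Riccati equation -/

/-- Continuous functions on the line with values in a compact subset of `(0, ∞)`. -/
structure UniformlyPositive (f : ℝ → ℝ) : Prop where
  continuous : Continuous f
  bounds : ∃ l u, 0 < l ∧ ∀ p, l ≤ f p ∧ f p ≤ u

namespace UniformlyPositive

variable {f h : ℝ → ℝ}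

lemma pos (hf : UniformlyPositive f) (p : ℝ) : 0 < f p := by
  obtain ⟨l, u, hl, hb⟩ := hf.bounds
  exact hl.trans_le (hb p).1

lemma const {x : ℝ} (hx : 0 < x) : UniformlyPositive fun _ => x :=
  ⟨continuous_const, x, x, hx, fun _ => ⟨le_rfl, le_rfl⟩⟩

lemma add (hf : UniformlyPositive f) (hh : UniformlyPositive h) :
    UniformlyPositive fun p => f p + h p := by
  obtain ⟨l, u, hl, hb⟩ := hf.bounds
  obtain ⟨l', u', hl', hb'⟩ := hh.bounds
  exact ⟨hf.continuous.add hh.continuous, l + l', u + u', by positivity, fun p =>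
    ⟨add_le_add (hb p).1 (hb' p).1, add_le_add (hb p).2 (hb' p).2⟩⟩

lemma mul (hf : UniformlyPositive f) (hh : UniformlyPositive h) :
    UniformlyPositive fun p => f p * h p := by
  obtain ⟨l, u, hl, hb⟩ := hf.bounds
  obtain ⟨l', u', hl', hb'⟩ := hh.bounds
  exact ⟨hf.continuous.mul hh.continuous, l * l', u * u', by positivity, fun p =>
    ⟨mul_le_mul (hb p).1 (hb' p).1 hl'.le (hf.pos p).le,
      mul_le_mul (hb p).2 (hb' p).2 (hh.pos p).le ((hf.pos p).le.trans (hb p).2)⟩⟩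

lemma inv (hf : UniformlyPositive f) : UniformlyPositive fun p => (f p)⁻¹ := by
  obtain ⟨l, u, hl, hb⟩ := hf.bounds
  have hu : 0 < u := (hf.pos 0).trans_le (hb 0).2
  exact ⟨hf.continuous.inv₀ fun p => (hf.pos p).ne', u⁻¹, l⁻¹, by positivity, fun p =>
    ⟨inv_anti₀ (hf.pos p) (hb p).2, inv_anti₀ hl (hb p).1⟩⟩

lemma div (hf : UniformlyPositive f) (hh : UniformlyPositive h) :
    UniformlyPositive fun p => f p / h p := by
  simpa only [div_eq_mul_inv] using hf.mul hh.inv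

lemma pow (hf : UniformlyPositive f) (n : ℕ) : UniformlyPositive fun p => f p ^ n := by
  induction n with
  | zero => simpa using const one_pos
  | succ n ih => simpa only [pow_succ] using ih.mul hf

end UniformlyPositive

/-- `w` is a bounded, uniformly positive solution of the Riccati equation `w' = Q - w² / P`.
It is the logarithmic derivative `P v' / v` of the solution `v` of `(P v')' = Q v` that decays
at `-∞`. -/
structure IsRiccati (P Q w : ℝ → ℝ) : Prop where
  hasDerivAt : ∀ p, HasDerivAt w (Q p - w p ^ 2 / P p) p
  uniformlyPositive : UniformlyPositive w

lemma exists_isRiccati {P Q : ℝ → ℝ} (hP : UniformlyPositive P) (hQ : UniformlyPositive Q) :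
    ∃ w, IsRiccati P Q w := by
  obtain ⟨P₀, P₁, hP₀, hPb⟩ := hP.bounds
  obtain ⟨Q₀, Q₁, hQ₀, hQb⟩ := hQ.bounds
  have hP₁ : 0 < P₁ := hP₀.trans_le ((hPb 0).1.trans (hPb 0).2)
  have hQ₁ : 0 < Q₁ := hQ₀.trans_le ((hQb 0).1.trans (hQb 0).2)
  -- `m` is a constant subsolution and `M` a constant supersolution
  set m := √(P₀ * Q₀) with hm
  set M := √(P₁ * Q₁) with hM
  have hmpos : 0 < m := by positivity
  have hMpos : 0 < M := by positivity
  have hm2 : m ^ 2 = P₀ * Q₀ := sq_sqrt (by positivity)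
  have hM2 : M ^ 2 = P₁ * Q₁ := sq_sqrt (by positivity)
  have hmM : m ≤ M := by
    refine sqrt_le_sqrt ?_
    exact mul_le_mul ((hPb 0).1.trans (hPb 0).2) ((hQb 0).1.trans (hQb 0).2) hQ₀.le hP₁.le
  have hmQ : ∀ p, m ^ 2 / P p ≤ Q p := fun p => by
    rw [div_le_iff₀ (hP.pos p), hm2, mul_comm]
    exact mul_le_mul (hQb p).1 (hPb p).1 hP₀.le (hQ.pos p).le
  have hMQ : ∀ p, Q p ≤ M ^ 2 / P p := fun p => by
    rw [le_div_iff₀ (hP.pos p), hM2, mul_comm]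
    exact mul_le_mul (hPb p).2 (hQb p).2 (hQ.pos p).le hP₁.le
  -- the nonlinearity is frozen outside `[m, M]`, which does not affect solutions with these bounds
  let y : ℝ → ℝ := fun x => max m (min M x)
  have hy : ∀ x, m ≤ y x ∧ y x ≤ M := fun x => ⟨le_max_left _ _, max_le hmM (min_le_left _ _)⟩
  have hylip : ∀ x x', |y x - y x'| ≤ |x - x'| := fun x x' =>
    (abs_max_sub_max_le_max _ _ _ _).trans (by
      simpa using abs_min_sub_min_le_max M x M x')
  set c := 2 * M / P₀ with hc
  have hcpos : 0 < c := by positivity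
  have hsum : ∀ p u v, m ≤ u → u ≤ M → m ≤ v → v ≤ M →
      2 * m / P₁ ≤ (u + v) / P p ∧ (u + v) / P p ≤ c := fun p u v h1 h2 h3 h4 => by
    constructor
    · exact div_le_div₀ (by linarith) (by linarith) (hP.pos p) (hPb p).2
    · exact div_le_div₀ (by positivity) (by linarith) hP₀ (hPb p).1
  obtain ⟨w, hw, hwb⟩ := exists_bounded_solution
    (f := fun p x => Q p + c * y x - y x ^ 2 / P p) (c := c) (k := c - 2 * m / P₁) (m := m) (M := M)
    (by
      have := hQ.continuous
      have hPi : Continuous fun p => (P p)⁻¹ := hP.inv.continuous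
      have hPi' : Continuous fun z : ℝ × ℝ => (P z.1)⁻¹ := hPi.comp continuous_fst
      simp only [Function.uncurry_def, y, div_eq_mul_inv]
      refine Continuous.sub (by fun_prop) (Continuous.mul (by fun_prop) hPi'))
    hcpos
    (by
      have := hsum 0 m m le_rfl hmM le_rfl hmM
      linarith)
    (by
      have : 0 < 2 * m / P₁ := by positivity
      linarith)
    (fun p x x' => by
      have h1 : Q p + c * y x - y x ^ 2 / P p - (Q p + c * y x' - y x' ^ 2 / P p)
          = (c - (y x + y x') / P p) * (y x - y x') := by ring
      obtain ⟨h2, h3⟩ := hsum p _ _ (hy x).1 (hy x).2 (hy x').1 (hy x').2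
      rw [h1, abs_mul, abs_of_nonneg (by linarith)]
      exact mul_le_mul (by linarith) (hylip _ _) (abs_nonneg _) (by linarith))
    (fun p x => by
      have h1 := (hsum p _ _ (hy x).1 (hy x).2 le_rfl hmM).2
      have h2 := mul_nonneg (sub_nonneg.2 h1) (sub_nonneg.2 (hy x).1)
      have h3 := hmQ p
      have h4 : (c - (y x + m) / P p) * (y x - m)
        = c * y x - c * m - y x ^ 2 / P p + m ^ 2 / P p := by ring
      linarith)
    (fun p x => by
      have h1 := (hsum p _ _ (hy x).1 (hy x).2 hmM le_rfl).2
      have h2 := mul_nonneg (sub_nonneg.2 h1) (sub_nonneg.2 (hy x).2)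
      have h3 := hMQ p
      have h4 : (c - (y x + M) / P p) * (M - y x)
        = c * M - c * y x + y x ^ 2 / P p - M ^ 2 / P p := by ring
      linarith)
  refine ⟨w, fun p => ?_, continuous_iff_continuousAt.2 fun p => (hw p).continuousAt, m, M,
    hmpos, hwb⟩
  have : y (w p) = w p := by
    simp only [y]
    rw [min_eq_right (hwb p).2, max_eq_right (hwb p).1]
  have h1 := hw p
  rw [this] at h1
  convert h1 using 1
  ring

section comparison

variable {P₁ Q₁ w₁ P₂ Q₂ w₂ : ℝ → ℝ} {K : ℝ}

/-- Comparison of Riccati solutions. The difference `d = w₂ - w₁` satisfies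
`d' = (Q₂ - Q₁) + w₁² (1/P₁ - 1/P₂) - d (w₁ + w₂) / P₂`. -/
lemma IsRiccati.sub_le (hP₂ : UniformlyPositive P₂) (h₁ : IsRiccati P₁ Q₁ w₁)
    (h₂ : IsRiccati P₂ Q₂ w₂)
    (hK : ∀ p < 0, Q₂ p - Q₁ p + w₁ p ^ 2 * (1 / P₁ p - 1 / P₂ p)
      ≤ K * ((w₁ p + w₂ p) / P₂ p)) : ∀ p ≤ 0, w₂ p - w₁ p ≤ K := by
  have hh := (h₁.uniformlyPositive.add h₂.uniformlyPositive).div hP₂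
  obtain ⟨h₀, _, h₀pos, hb⟩ := hh.bounds
  obtain ⟨m₁, M₁, hm₁, hb₁⟩ := h₁.uniformlyPositive.bounds
  obtain ⟨m₂, M₂, hm₂, hb₂⟩ := h₂.uniformlyPositive.bounds
  intro p hp
  refine sub_nonpos.1 (nonpos_of_deriv_le (D := fun p => w₂ p - w₁ p - K) (B := M₂ - m₁ - K)
    ((h₂.uniformlyPositive.continuous.sub h₁.uniformlyPositive.continuous).sub
      continuous_const).continuousOn
    (fun p _ => ((h₂.hasDerivAt p).sub (h₁.hasDerivAt p)).sub_const K) hh.continuous h₀pos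
    (fun p => (hb p).1) (fun p hp => ?_) (fun p _ => by linarith [(hb₂ p).2, (hb₁ p).1]) p hp)
  have := hK p hp
  have h3 : Q₂ p - w₂ p ^ 2 / P₂ p - (Q₁ p - w₁ p ^ 2 / P₁ p)
      = Q₂ p - Q₁ p + w₁ p ^ 2 * (1 / P₁ p - 1 / P₂ p)
        - (w₂ p - w₁ p) * ((w₁ p + w₂ p) / P₂ p) := by ring
  rw [h3]
  linarith

lemma IsRiccati.le_sub (hP₂ : UniformlyPositive P₂) (h₁ : IsRiccati P₁ Q₁ w₁)
    (h₂ : IsRiccati P₂ Q₂ w₂)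
    (hK : ∀ p < 0, K * ((w₁ p + w₂ p) / P₂ p)
      ≤ Q₂ p - Q₁ p + w₁ p ^ 2 * (1 / P₁ p - 1 / P₂ p)) : ∀ p ≤ 0, K ≤ w₂ p - w₁ p := by
  have hh := (h₁.uniformlyPositive.add h₂.uniformlyPositive).div hP₂
  obtain ⟨h₀, _, h₀pos, hb⟩ := hh.bounds
  obtain ⟨m₁, M₁, hm₁, hb₁⟩ := h₁.uniformlyPositive.bounds
  obtain ⟨m₂, M₂, hm₂, hb₂⟩ := h₂.uniformlyPositive.bounds
  intro p hp
  refine sub_nonpos.1 (nonpos_of_deriv_le (D := fun p => K - (w₂ p - w₁ p)) (B := K - (m₂ - M₁))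
    (continuous_const.sub
      (h₂.uniformlyPositive.continuous.sub h₁.uniformlyPositive.continuous)).continuousOn
    (fun p _ => ((h₂.hasDerivAt p).sub (h₁.hasDerivAt p)).const_sub K) hh.continuous h₀pos
    (fun p => (hb p).1) (fun p hp => ?_) (fun p _ => by linarith [(hb₂ p).1, (hb₁ p).2]) p hp)
  have := hK p hp
  have h3 : Q₂ p - w₂ p ^ 2 / P₂ p - (Q₁ p - w₁ p ^ 2 / P₁ p)
      = Q₂ p - Q₁ p + w₁ p ^ 2 * (1 / P₁ p - 1 / P₂ p)
        - (w₂ p - w₁ p) * ((w₁ p + w₂ p) / P₂ p) := by ring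
  rw [h3]
  linarith

lemma IsRiccati.mono (hP₁ : UniformlyPositive P₁) (hP₂ : UniformlyPositive P₂)
    (h₁ : IsRiccati P₁ Q₁ w₁) (h₂ : IsRiccati P₂ Q₂ w₂)
    (hP : ∀ p < 0, P₁ p ≤ P₂ p) (hQ : ∀ p < 0, Q₁ p ≤ Q₂ p) : ∀ p ≤ 0, w₁ p ≤ w₂ p := by
  intro p hp
  refine sub_nonneg.1 (h₁.le_sub hP₂ h₂ (K := 0) (fun p hp => ?_) p hp)
  have h1 : 1 / P₂ p ≤ 1 / P₁ p := one_div_le_one_div_of_le (hP₁.pos p) (hP p hp)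
  have h2 := mul_nonneg (sq_nonneg (w₁ p)) (sub_nonneg.2 h1)
  linarith [hQ p hp]

lemma IsRiccati.strict_mono (hP₁ : UniformlyPositive P₁) (hP₂ : UniformlyPositive P₂)
    (h₁ : IsRiccati P₁ Q₁ w₁) (h₂ : IsRiccati P₂ Q₂ w₂)
    (hP : ∀ p < 0, P₁ p ≤ P₂ p) {s : ℝ} (hs : 0 < s) (hQ : ∀ p < 0, Q₁ p + s ≤ Q₂ p) :
    ∀ p ≤ 0, w₁ p < w₂ p := by
  obtain ⟨l, u, hl, hb⟩ := ((h₁.uniformlyPositive.add h₂.uniformlyPositive).div hP₂).bounds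
  have hu : 0 < u := hl.trans_le ((hb 0).1.trans (hb 0).2)
  intro p hp
  have hK : 0 < s / u := by positivity
  refine sub_pos.1 (hK.trans_le (h₁.le_sub hP₂ h₂ (K := s / u) (fun p hp => ?_) p hp))
  have h1 : 1 / P₂ p ≤ 1 / P₁ p := one_div_le_one_div_of_le (hP₁.pos p) (hP p hp)
  have h2 := mul_nonneg (sq_nonneg (w₁ p)) (sub_nonneg.2 h1)
  have h3 : s / u * ((w₁ p + w₂ p) / P₂ p) ≤ s / u * u :=
    mul_le_mul_of_nonneg_left (hb p).2 hK.le
  rw [div_mul_cancel₀ _ hu.ne'] at h3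
  linarith [hQ p hp]

/-- Continuous dependence of the Riccati solution on the coefficients. -/
lemma IsRiccati.abs_sub_le (hP₂ : UniformlyPositive P₂) (h₁ : IsRiccati P₁ Q₁ w₁)
    (h₂ : IsRiccati P₂ Q₂ w₂) {m M B η : ℝ} (hm : 0 < m) (hmM : ∀ p, m ≤ w₁ p ∧ w₁ p ≤ M)
    (hB : ∀ p, P₂ p ≤ B) (hQ : ∀ p < 0, |Q₂ p - Q₁ p| ≤ η)
    (hP : ∀ p < 0, |1 / P₁ p - 1 / P₂ p| ≤ η) :
    ∀ p ≤ 0, |w₂ p - w₁ p| ≤ η * ((1 + M ^ 2) * B / m) := by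
  have hη : 0 ≤ η := (abs_nonneg _).trans (hQ (-1) (by norm_num))
  have hBpos : 0 < B := (hP₂.pos 0).trans_le (hB 0)
  have key : ∀ p < 0, |Q₂ p - Q₁ p + w₁ p ^ 2 * (1 / P₁ p - 1 / P₂ p)|
      ≤ η * ((1 + M ^ 2) * B / m) * ((w₁ p + w₂ p) / P₂ p) := fun p hp => by
    have h1 : m / B ≤ (w₁ p + w₂ p) / P₂ p :=
      div_le_div₀ (by linarith [h₁.uniformlyPositive.pos p, h₂.uniformlyPositive.pos p])
        (by linarith [(hmM p).1, h₂.uniformlyPositive.pos p]) (hP₂.pos p) (hB p)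
    have h2 : |Q₂ p - Q₁ p + w₁ p ^ 2 * (1 / P₁ p - 1 / P₂ p)| ≤ η + M ^ 2 * η := by
      refine (abs_add_le _ _).trans (add_le_add (hQ p hp) ?_)
      rw [abs_mul, abs_of_nonneg (sq_nonneg _)]
      refine mul_le_mul ?_ (hP p hp) (abs_nonneg _) (sq_nonneg _)
      exact pow_le_pow_left₀ (h₁.uniformlyPositive.pos p).le (hmM p).2 2
    calc _ ≤ η + M ^ 2 * η := h2
      _ = η * ((1 + M ^ 2) * B / m) * (m / B) := by field_simp
      _ ≤ _ := by gcongr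
  intro p hp
  rw [abs_le]
  constructor
  · refine h₁.le_sub hP₂ h₂ (fun p hp => ?_) p hp
    rw [neg_mul]
    exact (abs_le.1 (key p hp)).1
  · exact h₁.sub_le hP₂ h₂ (fun p hp => (abs_le.1 (key p hp)).2) p hp

/-- The variational upper bound for `w(0)` with the test function `e^p`. -/
lemma IsRiccati.le_integral {P Q w : ℝ → ℝ} (hP : UniformlyPositive P) (hQ : UniformlyPositive Q)
    (h : IsRiccati P Q w) : w 0 ≤ ∫ p in Iic (0 : ℝ), (P p + Q p) * exp (2 * p) := by
  have hexp : IntegrableOn (fun p => exp (2 * p)) (Iic (0 : ℝ)) :=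
    integrableOn_exp_mul_Iic two_pos 0
  have hint : ∀ f : ℝ → ℝ, Continuous f → (∃ C, ∀ p, |f p| ≤ C) →
      IntegrableOn (fun p => f p * exp (2 * p)) (Iic (0 : ℝ)) := fun f hf ⟨C, hC⟩ => by
    refine Integrable.mono' (hexp.const_mul C) (by fun_prop) (ae_of_all _ fun p => ?_)
    rw [norm_mul, Real.norm_eq_abs, Real.norm_eq_abs, abs_of_pos (exp_pos _)]
    exact mul_le_mul_of_nonneg_right (hC p) (exp_pos _).le
  have hbdd : ∀ {f}, UniformlyPositive f → ∃ C, ∀ p, |f p| ≤ C := fun {f} hf => by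
    obtain ⟨l, u, hl, hb⟩ := hf.bounds
    exact ⟨u, fun p => by rw [abs_of_pos (hf.pos p)]; exact (hb p).2⟩
  have hw := h.uniformlyPositive
  have hd : ∀ p ∈ Iic (0 : ℝ), HasDerivAt (fun p => w p * exp (2 * p))
      ((Q p - w p ^ 2 / P p + 2 * w p) * exp (2 * p)) p := fun p _ => by
    have h1 : HasDerivAt (fun p : ℝ => exp (2 * p)) (exp (2 * p) * (2 * 1)) p :=
      ((hasDerivAt_id p).const_mul 2).exp
    refine ((h.hasDerivAt p).mul h1).congr_deriv ?_
    ring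
  obtain ⟨C, hC⟩ := hbdd hw
  have htend : Tendsto (fun p => w p * exp (2 * p)) atBot (𝓝 0) := by
    have h1 : Tendsto (fun p : ℝ => exp (2 * p)) atBot (𝓝 0) :=
      tendsto_exp_atBot.comp (tendsto_id.const_mul_atBot two_pos)
    refine squeeze_zero_norm (fun p => ?_) (by simpa using h1.const_mul C)
    rw [norm_mul, Real.norm_eq_abs, Real.norm_eq_abs, abs_of_pos (exp_pos _)]
    exact mul_le_mul_of_nonneg_right (hC p) (exp_pos _).le
  have hQ' := hbdd hQ
  have hw2 := hbdd ((hw.pow 2).div hP)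
  have hint1 : IntegrableOn (fun p => (Q p - w p ^ 2 / P p + 2 * w p) * exp (2 * p))
      (Iic (0 : ℝ)) := by
    refine hint _ ((hQ.continuous.sub ((hw.pow 2).div hP).continuous).add
      (continuous_const.mul hw.continuous)) ?_
    obtain ⟨C1, hC1⟩ := hQ'
    obtain ⟨C2, hC2⟩ := hw2
    refine ⟨C1 + C2 + 2 * C, fun p => ?_⟩
    refine (abs_add_le _ _).trans (add_le_add ((abs_sub _ _).trans
      (add_le_add (hC1 p) (hC2 p))) ?_)
    rw [abs_mul, abs_two]
    exact mul_le_mul_of_nonneg_left (hC p) two_pos.le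
  have h1 := integral_Iic_of_hasDerivAt_of_tendsto' hd hint1 htend
  simp only [mul_zero, exp_zero, mul_one, sub_zero] at h1
  rw [← h1]
  refine setIntegral_mono hint1 (hint _ (hP.add hQ).continuous (hbdd (hP.add hQ))) fun p => ?_
  refine mul_le_mul_of_nonneg_right ?_ (exp_pos _).le
  have hPp := hP.pos p
  have h2 : P p + w p ^ 2 / P p - 2 * w p = (w p - P p) ^ 2 / P p := by
    field_simp
    ring
  have h3 : 0 ≤ (w p - P p) ^ 2 / P p := by positivity
  linarith

end comparison

/-! ### The coefficients -/

/-- The vorticity `γ(-p)`, extended to `p > 0` by the constant `γ(0)`. -/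
noncomputable def vortExt (γ : ℝ → ℝ) (p : ℝ) : ℝ := γ (max (-p) 0)

/-- The coefficient `a(p; lam)`, extended to `p > 0` by the constant `a(0; lam)`. -/
noncomputable def aExt (γ : ℝ → ℝ) (lam p : ℝ) : ℝ := aCoef γ lam (min p 0)

/-- The zeroth order coefficient of the ordinary differential equation
`(a³ v')' = (κ a + ε a³) v` for a single Fourier mode. -/
noncomputable def qCoef (γ : ℝ → ℝ) (lam κ ε p : ℝ) : ℝ :=
  κ * aExt γ lam p + ε * aExt γ lam p ^ 3

lemma GamInf_le {γ : ℝ → ℝ} (hΓ : GamBounded γ) {p : ℝ} (hp : p ≤ 0) : GamInf γ ≤ Gam γ p := by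
  obtain ⟨M, hM⟩ := hΓ
  refine csInf_le ⟨-M, ?_⟩ ⟨p, hp, rfl⟩
  rintro _ ⟨q, hq, rfl⟩
  exact (abs_le.1 (hM q hq)).1

lemma Gam_zero (γ : ℝ → ℝ) : Gam γ 0 = 0 := by simp [Gam]

lemma GamInf_nonpos {γ : ℝ → ℝ} (hΓ : GamBounded γ) : GamInf γ ≤ 0 :=
  (GamInf_le hΓ le_rfl).trans_eq (Gam_zero γ)

lemma continuous_vortExt {α : ℝ} {γ : ℝ → ℝ} (hγ : HolderC1 α γ) : Continuous (vortExt γ) :=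
  hγ.contDiffOn.continuousOn.comp_continuous (by fun_prop) fun _ =>
    mem_Ici.2 (le_max_right _ _)

lemma vortExt_of_nonpos (γ : ℝ → ℝ) {p : ℝ} (hp : p ≤ 0) : vortExt γ p = γ (-p) := by
  rw [vortExt, max_eq_left (by linarith)]

lemma Gam_eq_integral_vortExt (γ : ℝ → ℝ) {p : ℝ} (hp : p ≤ 0) :
    Gam γ p = ∫ s in (0 : ℝ)..p, vortExt γ s := by
  refine intervalIntegral.integral_congr fun s hs => ?_
  rw [uIcc_of_ge hp] at hs
  exact (vortExt_of_nonpos γ hs.2).symm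

lemma hasDerivWithinAt_Gam {α : ℝ} {γ : ℝ → ℝ} (hγ : HolderC1 α γ) {p : ℝ} (hp : p ≤ 0) :
    HasDerivWithinAt (Gam γ) (γ (-p)) (Iic 0) p := by
  have hc := continuous_vortExt hγ
  have h1 : HasDerivAt (fun p => ∫ s in (0 : ℝ)..p, vortExt γ s) (vortExt γ p) p :=
    intervalIntegral.integral_hasDerivAt_right (hc.intervalIntegrable _ _)
      (hc.stronglyMeasurableAtFilter _ _) hc.continuousAt
  rw [vortExt_of_nonpos γ hp] at h1
  exact h1.hasDerivWithinAt.congr (fun q hq => Gam_eq_integral_vortExt γ hq)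
    (Gam_eq_integral_vortExt γ hp)

lemma continuousOn_Gam {α : ℝ} {γ : ℝ → ℝ} (hγ : HolderC1 α γ) : ContinuousOn (Gam γ) (Iic 0) :=
  fun _ hp => (hasDerivWithinAt_Gam hγ hp).continuousWithinAt

lemma continuous_Gam_min {α : ℝ} {γ : ℝ → ℝ} (hγ : HolderC1 α γ) :
    Continuous fun p => Gam γ (min p 0) :=
  (continuousOn_Gam hγ).comp_continuous (by fun_prop) fun _ =>
    mem_Iic.2 (min_le_right _ _)

lemma aExt_of_nonpos (γ : ℝ → ℝ) (lam : ℝ) {p : ℝ} (hp : p ≤ 0) :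
    aExt γ lam p = aCoef γ lam p := by rw [aExt, min_eq_left hp]

section

variable {α : ℝ} {γ : ℝ → ℝ} {lam : ℝ}

lemma aExt_sq (hΓ : GamBounded γ) (hlam : -2 * GamInf γ < lam) (p : ℝ) :
    aExt γ lam p ^ 2 = lam + 2 * Gam γ (min p 0) :=
  sq_sqrt (by linarith [GamInf_le hΓ (min_le_right p 0)])

lemma continuous_aExt (hγ : HolderC1 α γ) (lam : ℝ) : Continuous (aExt γ lam) :=
  (continuous_const.add (continuous_const.mul (continuous_Gam_min hγ))).sqrt

lemma uniformlyPositive_aExt (hγ : HolderC1 α γ) (hΓ : GamBounded γ)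
    (hlam : -2 * GamInf γ < lam) : UniformlyPositive (aExt γ lam) := by
  obtain ⟨M, hM⟩ := hΓ
  refine ⟨continuous_aExt hγ lam, √(lam + 2 * GamInf γ), √(lam + 2 * M),
    sqrt_pos.2 (by linarith), fun p => ⟨sqrt_le_sqrt ?_, sqrt_le_sqrt ?_⟩⟩
  · linarith [GamInf_le ⟨M, hM⟩ (min_le_right p 0)]
  · linarith [(abs_le.1 (hM (min p 0) (min_le_right p 0))).2]

lemma uniformlyPositive_qCoef (hγ : HolderC1 α γ) (hΓ : GamBounded γ)
    (hlam : -2 * GamInf γ < lam) {κ ε : ℝ} (hκ : 0 ≤ κ) (hε : 0 ≤ ε) (hκε : 0 < κ + ε) :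
    UniformlyPositive (qCoef γ lam κ ε) := by
  have ha := uniformlyPositive_aExt hγ hΓ hlam
  rcases hκ.eq_or_lt with rfl | hκ
  · have := (UniformlyPositive.const (by linarith : 0 < ε)).mul (ha.pow 3)
    have hq : qCoef γ lam 0 ε = fun p => ε * aExt γ lam p ^ 3 := by funext p; simp [qCoef]
    rwa [hq]
  rcases hε.eq_or_lt with rfl | hε
  · have hq : qCoef γ lam κ 0 = fun p => κ * aExt γ lam p := by funext p; simp [qCoef]
    simpa [hq] using (UniformlyPositive.const hκ).mul ha
  · exact ((UniformlyPositive.const hκ).mul ha).add ((UniformlyPositive.const hε).mul (ha.pow 3))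

/-- The bounded, uniformly positive solution of the Riccati equation of the Fourier mode with
parameter `κ`, with the coefficients extended to the whole line; by convention `0` if there is
none (`isRiccati_riccati` gives existence for all parameters of interest). -/
noncomputable def riccati (γ : ℝ → ℝ) (lam κ ε : ℝ) : ℝ → ℝ :=
  open Classical in
  if h : ∃ w, IsRiccati (fun p => aExt γ lam p ^ 3) (qCoef γ lam κ ε) w then h.choose else 0

lemma isRiccati_riccati (hγ : HolderC1 α γ) (hΓ : GamBounded γ)
    (hlam : -2 * GamInf γ < lam) {κ ε : ℝ} (hκ : 0 ≤ κ) (hε : 0 ≤ ε) (hκε : 0 < κ + ε) :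
    IsRiccati (fun p => aExt γ lam p ^ 3) (qCoef γ lam κ ε) (riccati γ lam κ ε) := by
  have h := exists_isRiccati ((uniformlyPositive_aExt hγ hΓ hlam).pow 3)
    (uniformlyPositive_qCoef hγ hΓ hlam hκ hε hκε)
  rw [riccati, dif_pos h]
  exact h.choose_spec

/-! ### Dependence of `w(0)` on the parameters -/

lemma riccati_zero_strictMono_lam (hγ : HolderC1 α γ) (hΓ : GamBounded γ) {lam' κ ε : ℝ}
    (hlam : -2 * GamInf γ < lam) (hlt : lam < lam') (hκ : 0 < κ) (hε : 0 ≤ ε) :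
    riccati γ lam κ ε 0 < riccati γ lam' κ ε 0 := by
  have hlam' := hlam.trans hlt
  have ha := uniformlyPositive_aExt hγ hΓ hlam
  have ha' := uniformlyPositive_aExt hγ hΓ hlam'
  have hle : ∀ p, aExt γ lam p ≤ aExt γ lam' p := fun p => sqrt_le_sqrt (by linarith)
  obtain ⟨l, u, hl, hb⟩ := (ha.add ha').bounds
  have hu : 0 < u := hl.trans_le ((hb 0).1.trans (hb 0).2)
  refine IsRiccati.strict_mono (s := κ * ((lam' - lam) / u)) (ha.pow 3) (ha'.pow 3)
    (isRiccati_riccati hγ hΓ hlam hκ.le hε (by linarith))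
    (isRiccati_riccati hγ hΓ hlam' hκ.le hε (by linarith)) (fun p _ => ?_) ?_ (fun p _ => ?_) 0
    le_rfl
  · exact pow_le_pow_left₀ (ha.pos p).le (hle p) 3
  · have : 0 < lam' - lam := sub_pos.2 hlt
    positivity
  · have h1 : (lam' - lam) / u ≤ aExt γ lam' p - aExt γ lam p := by
      rw [div_le_iff₀ hu]
      have h2 := aExt_sq hΓ hlam p
      have h3 := aExt_sq hΓ hlam' p
      have h4 := mul_le_mul_of_nonneg_left (hb p).2 (sub_nonneg.2 (hle p))
      nlinarith
    have h5 := mul_le_mul_of_nonneg_left h1 hκ.le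
    have h6 : ε * aExt γ lam p ^ 3 ≤ ε * aExt γ lam' p ^ 3 :=
      mul_le_mul_of_nonneg_left (pow_le_pow_left₀ (ha.pos p).le (hle p) 3) hε
    simp only [qCoef]
    linarith

lemma riccati_zero_strictMono_mode (hγ : HolderC1 α γ) (hΓ : GamBounded γ) {κ κ' ε : ℝ}
    (hlam : -2 * GamInf γ < lam) (hκ : 0 ≤ κ) (hlt : κ < κ') (hε : 0 ≤ ε) (hκε : 0 < κ + ε) :
    riccati γ lam κ ε 0 < riccati γ lam κ' ε 0 := by
  have ha := uniformlyPositive_aExt hγ hΓ hlam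
  obtain ⟨l, u, hl, hb⟩ := ha.bounds
  refine IsRiccati.strict_mono (s := (κ' - κ) * l) (ha.pow 3) (ha.pow 3)
    (isRiccati_riccati hγ hΓ hlam hκ hε hκε)
    (isRiccati_riccati hγ hΓ hlam (hκ.trans hlt.le) hε (by linarith)) (fun p _ => le_rfl)
    (mul_pos (sub_pos.2 hlt) hl) (fun p _ => ?_) 0 le_rfl
  have := mul_le_mul_of_nonneg_left (hb p).1 (sub_nonneg.2 hlt.le)
  simp only [qCoef]
  linarith

lemma riccati_zero_mono_eps (hγ : HolderC1 α γ) (hΓ : GamBounded γ) {κ ε ε' : ℝ}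
    (hlam : -2 * GamInf γ < lam) (hκ : 0 < κ) (hε : 0 ≤ ε) (hle : ε ≤ ε') :
    riccati γ lam κ ε 0 ≤ riccati γ lam κ ε' 0 := by
  have ha := uniformlyPositive_aExt hγ hΓ hlam
  refine IsRiccati.mono (ha.pow 3) (ha.pow 3)
    (isRiccati_riccati hγ hΓ hlam hκ.le hε (by linarith))
    (isRiccati_riccati hγ hΓ hlam hκ.le (hε.trans hle) (by linarith)) (fun p _ => le_rfl)
    (fun p _ => ?_) 0 le_rfl
  have := mul_le_mul_of_nonneg_right hle ((ha.pow 3).pos p).le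
  simp only [qCoef]
  linarith

lemma tendsto_riccati_zero_eps (hγ : HolderC1 α γ) (hΓ : GamBounded γ) {κ : ℝ}
    (hlam : -2 * GamInf γ < lam) (hκ : 0 < κ) :
    Tendsto (fun ε => riccati γ lam κ ε 0) (𝓝[>] 0) (𝓝 (riccati γ lam κ 0 0)) := by
  have ha := (uniformlyPositive_aExt hγ hΓ hlam).pow 3
  have h0 := isRiccati_riccati hγ hΓ hlam hκ.le le_rfl (by linarith)
  obtain ⟨l, u, hl, hb⟩ := ha.bounds
  obtain ⟨m, M, hm, hmM⟩ := h0.uniformlyPositive.bounds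
  rw [tendsto_iff_norm_sub_tendsto_zero]
  have hlim : Tendsto (fun ε : ℝ => ε * u * ((1 + M ^ 2) * u / m)) (𝓝[>] 0) (𝓝 0) := by
    have : Continuous fun ε : ℝ => ε * u * ((1 + M ^ 2) * u / m) := by fun_prop
    simpa using (this.tendsto 0).mono_left nhdsWithin_le_nhds
  refine squeeze_zero' (Eventually.of_forall fun _ => norm_nonneg _) ?_ hlim
  filter_upwards [self_mem_nhdsWithin] with ε hε
  have hε : 0 < ε := hε
  refine h0.abs_sub_le ha (isRiccati_riccati hγ hΓ hlam hκ.le hε.le (by linarith)) hm hmM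
    (fun p => (hb p).2) (fun p _ => ?_) (fun p _ => ?_) 0 le_rfl
  · have h1 : qCoef γ lam κ ε p - qCoef γ lam κ 0 p = ε * aExt γ lam p ^ 3 := by
      simp only [qCoef]; ring
    rw [h1, abs_of_nonneg (mul_nonneg hε.le (ha.pos p).le)]
    exact mul_le_mul_of_nonneg_left (hb p).2 hε.le
  · have : 0 ≤ ε * u := mul_nonneg hε.le ((ha.pos p).le.trans (hb p).2)
    simpa using this

lemma continuousAt_riccati_zero_lam (hγ : HolderC1 α γ) (hΓ : GamBounded γ) {κ ε : ℝ}
    (hlam : -2 * GamInf γ < lam) (hκ : 0 < κ) (hε : 0 ≤ ε) :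
    ContinuousAt (fun μ => riccati γ μ κ ε 0) lam := by
  have hΓ' := hΓ
  obtain ⟨G, hG⟩ := hΓ'
  have h0 := isRiccati_riccati hγ hΓ hlam hκ.le hε (by linarith)
  obtain ⟨m, M, hm, hmM⟩ := h0.uniformlyPositive.bounds
  set δ := (lam + 2 * GamInf γ) / 2 with hδ
  have hδpos : 0 < δ := by rw [hδ]; linarith
  set l := √δ with hl
  set u := √(lam + δ + 2 * G) with hu
  have hlpos : 0 < l := sqrt_pos.2 hδpos
  have hbd : ∀ μ, |μ - lam| ≤ δ → ∀ p, l ≤ aExt γ μ p ∧ aExt γ μ p ≤ u := fun μ hμ p => by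
    obtain ⟨h1, h2⟩ := abs_le.1 hμ
    have h3 := GamInf_le hΓ (min_le_right p 0)
    have h4 := (abs_le.1 (hG _ (min_le_right p 0))).2
    constructor <;> apply sqrt_le_sqrt <;> linarith
  set C := 1 / (2 * l) with hC
  have hCpos : 0 < C := by positivity
  have hupos : 0 < u := by
    have := hbd lam (by simpa using hδpos.le) 0
    linarith [this.1, this.2]
  set C' := κ * C + ε * (3 * u ^ 2 * C) + 3 * u ^ 2 * C / l ^ 6 with hC'
  rw [ContinuousAt, tendsto_iff_norm_sub_tendsto_zero]
  have hlim : Tendsto (fun μ : ℝ => |μ - lam| * C' * ((1 + M ^ 2) * u ^ 3 / m)) (𝓝 lam) (𝓝 0) := by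
    have : Continuous fun μ : ℝ => |μ - lam| * C' * ((1 + M ^ 2) * u ^ 3 / m) := by fun_prop
    simpa using this.tendsto lam
  refine squeeze_zero' (Eventually.of_forall fun _ => norm_nonneg _) ?_ hlim
  filter_upwards [Metric.closedBall_mem_nhds lam hδpos] with μ hμ
  rw [Metric.mem_closedBall, Real.dist_eq] at hμ
  have hμlam : -2 * GamInf γ < μ := by linarith [(abs_le.1 hμ).1]
  have hb0 := hbd lam (by simpa using hδpos.le)
  have hb := hbd μ hμ
  have hdiff : ∀ p, |aExt γ μ p - aExt γ lam p| ≤ |μ - lam| * C := fun p => by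
    have h1 : (aExt γ μ p - aExt γ lam p) * (aExt γ μ p + aExt γ lam p) = μ - lam := by
      linear_combination aExt_sq hΓ hμlam p - aExt_sq hΓ hlam p
    rw [hC, mul_one_div, le_div_iff₀ (by positivity), ← h1, abs_mul]
    refine mul_le_mul_of_nonneg_left ?_ (abs_nonneg _)
    exact le_trans (by linarith [(hb p).1, (hb0 p).1]) (le_abs_self _)
  have hcube : ∀ p, |aExt γ μ p ^ 3 - aExt γ lam p ^ 3| ≤ |μ - lam| * (3 * u ^ 2 * C) := fun p => by
    have h1 : aExt γ μ p ^ 3 - aExt γ lam p ^ 3 = (aExt γ μ p - aExt γ lam p)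
        * (aExt γ μ p ^ 2 + aExt γ μ p * aExt γ lam p + aExt γ lam p ^ 2) := by ring
    obtain ⟨h2, h3⟩ := hb p
    obtain ⟨h4, h5⟩ := hb0 p
    have h6 : 0 ≤ aExt γ μ p := hlpos.le.trans h2
    have h7 : 0 ≤ aExt γ lam p := hlpos.le.trans h4
    have h8 : |aExt γ μ p ^ 2 + aExt γ μ p * aExt γ lam p + aExt γ lam p ^ 2| ≤ 3 * u ^ 2 := by
      rw [abs_of_nonneg (by positivity)]
      nlinarith
    rw [h1, abs_mul]
    calc _ ≤ |μ - lam| * C * (3 * u ^ 2) :=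
          mul_le_mul (hdiff p) h8 (abs_nonneg _) (by positivity)
      _ = _ := by ring
  have hμa := (uniformlyPositive_aExt hγ hΓ hμlam).pow 3
  refine h0.abs_sub_le hμa (isRiccati_riccati hγ hΓ hμlam hκ.le hε (by linarith)) hm hmM
    (fun p => pow_le_pow_left₀ (hlpos.le.trans (hb p).1) (hb p).2 3) (fun p _ => ?_)
    (fun p _ => ?_) 0 le_rfl
  · have h1 : qCoef γ μ κ ε p - qCoef γ lam κ ε p = κ * (aExt γ μ p - aExt γ lam p)
        + ε * (aExt γ μ p ^ 3 - aExt γ lam p ^ 3) := by simp only [qCoef]; ring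
    rw [h1]
    refine (abs_add_le _ _).trans ?_
    rw [abs_mul, abs_mul, abs_of_pos hκ, abs_of_nonneg hε]
    have h2 := mul_le_mul_of_nonneg_left (hdiff p) hκ.le
    have h3 := mul_le_mul_of_nonneg_left (hcube p) hε
    have h4 : 0 ≤ |μ - lam| * (3 * u ^ 2 * C / l ^ 6) := by positivity
    calc _ ≤ κ * (|μ - lam| * C) + ε * (|μ - lam| * (3 * u ^ 2 * C)) := add_le_add h2 h3
      _ ≤ κ * (|μ - lam| * C) + ε * (|μ - lam| * (3 * u ^ 2 * C))
          + |μ - lam| * (3 * u ^ 2 * C / l ^ 6) := by linarith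
      _ = _ := by rw [hC']; ring
  · have hpos : 0 < aExt γ μ p := hlpos.trans_le (hb p).1
    have hpos0 : 0 < aExt γ lam p := hlpos.trans_le (hb0 p).1
    have h1 : 1 / aExt γ lam p ^ 3 - 1 / aExt γ μ p ^ 3
        = (aExt γ μ p ^ 3 - aExt γ lam p ^ 3) / (aExt γ lam p ^ 3 * aExt γ μ p ^ 3) := by
      field_simp
    have h2 : l ^ 6 ≤ aExt γ lam p ^ 3 * aExt γ μ p ^ 3 := by
      have h3 := pow_le_pow_left₀ hlpos.le (hb p).1 3
      have h4 := pow_le_pow_left₀ hlpos.le (hb0 p).1 3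
      calc l ^ 6 = l ^ 3 * l ^ 3 := by ring
        _ ≤ _ := mul_le_mul h4 h3 (by positivity) (by positivity)
    rw [h1, abs_div, abs_of_pos (by positivity : 0 < aExt γ lam p ^ 3 * aExt γ μ p ^ 3)]
    calc _ ≤ |μ - lam| * (3 * u ^ 2 * C) / l ^ 6 :=
          div_le_div₀ (by positivity) (hcube p) (by positivity) h2
      _ = |μ - lam| * (3 * u ^ 2 * C / l ^ 6) := by ring
      _ ≤ |μ - lam| * C' := by
          refine mul_le_mul_of_nonneg_left ?_ (abs_nonneg _)
          rw [hC']
          have : 0 ≤ κ * C + ε * (3 * u ^ 2 * C) := by positivity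
          linarith

/-- The integral condition keeps `w(0)` below `g` when `lam` is close to `-2 Γ_inf`. -/
lemma eventually_riccati_zero_lt {g L : ℝ} (hL : 0 < L) (hγ : HolderC1 α γ) (hΓ : GamBounded γ)
    (hbif : BifurcationCondition g L γ) {ε : ℝ} (hε : 0 ≤ ε) (hε1 : ε ≤ 1) :
    ∀ᶠ δ in 𝓝[>] (0 : ℝ), riccati γ (-2 * GamInf γ + δ) ((π / L) ^ 2) ε 0 < g := by
  have hκ : 0 < (π / L) ^ 2 := by positivity
  set κ := (π / L) ^ 2 with hκdef
  have hΓ' := hΓ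
  obtain ⟨G, hG⟩ := hΓ'
  let x : ℝ → ℝ := fun p => 2 * Gam γ (min p 0) - 2 * GamInf γ
  have hx : Continuous x :=
    (continuous_const.mul (continuous_Gam_min hγ)).sub continuous_const
  have hx0 : ∀ p, 0 ≤ x p := fun p => by linarith [GamInf_le hΓ (min_le_right p 0)]
  have hxG : ∀ p, x p ≤ 2 * G - 2 * GamInf γ := fun p => by
    linarith [(abs_le.1 (hG _ (min_le_right p 0))).2]
  let J : ℝ → ℝ → ℝ := fun δ p => (2 * √(δ + x p) ^ 3 + κ * √(δ + x p)) * exp (2 * p)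
  set U := √(1 + (2 * G - 2 * GamInf γ)) with hU
  have hJc : ContinuousAt (fun δ => ∫ p in Iic (0 : ℝ), J δ p) 0 := by
    refine continuousAt_of_dominated (bound := fun p => (2 * U ^ 3 + κ * U) * exp (2 * p))
      (Eventually.of_forall fun δ => ?_) ?_
      ((integrableOn_exp_mul_Iic two_pos 0).const_mul _) (ae_of_all _ fun p => ?_)
    · have : Continuous (J δ) := by simp only [J]; fun_prop
      exact this.aestronglyMeasurable
    · filter_upwards [Iic_mem_nhds (zero_lt_one (α := ℝ))] with δ hδ
      refine ae_of_all _ fun p => ?_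
      have h1 : √(δ + x p) ≤ U := sqrt_le_sqrt (add_le_add hδ (hxG p))
      have h2 := sqrt_nonneg (δ + x p)
      rw [Real.norm_eq_abs, abs_of_nonneg (by positivity)]
      simp only [J]
      gcongr
    · have : Continuous fun δ => J δ p := by simp only [J]; fun_prop
      exact this.continuousAt
  have hJ0 : ∫ p in Iic (0 : ℝ), J 0 p < g := by
    refine lt_of_eq_of_lt (setIntegral_congr_fun measurableSet_Iic fun p hp => ?_) hbif
    have h1 : x p = 2 * Gam γ p - 2 * GamInf γ := by
      simp only [x, min_eq_left (show p ≤ 0 from hp)]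
    simp only [J, zero_add]
    rw [← h1, rpow_div_two_eq_sqrt 3 (hx0 p), rpow_div_two_eq_sqrt 1 (hx0 p), rpow_one]
    norm_cast
  filter_upwards [(hJc.eventually (gt_mem_nhds hJ0)).filter_mono nhdsWithin_le_nhds,
    self_mem_nhdsWithin] with δ hδ hδpos
  have hδpos : 0 < δ := hδpos
  have hlam : -2 * GamInf γ < -2 * GamInf γ + δ := by linarith
  refine lt_of_le_of_lt ?_ hδ
  have ha := uniformlyPositive_aExt hγ hΓ hlam
  have hq := uniformlyPositive_qCoef hγ hΓ hlam hκ.le hε (by linarith)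
  refine ((isRiccati_riccati hγ hΓ hlam hκ.le hε (by linarith)).le_integral (ha.pow 3) hq).trans ?_
  have hax : ∀ p, aExt γ (-2 * GamInf γ + δ) p = √(δ + x p) := fun p => by
    simp only [aExt, aCoef, x]
    congr 1
    ring
  refine integral_mono_of_nonneg (ae_of_all _ fun p => ?_) ?_ (ae_of_all _ fun p => ?_)
  · exact mul_nonneg (add_pos ((ha.pow 3).pos p) (hq.pos p)).le (exp_pos _).le
  · refine Integrable.mono' (g := fun p => (2 * √(δ + (2 * G - 2 * GamInf γ)) ^ 3
        + κ * √(δ + (2 * G - 2 * GamInf γ))) * exp (2 * p))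
      ((integrableOn_exp_mul_Iic two_pos 0).const_mul _) ?_ (ae_of_all _ fun p => ?_)
    · have : Continuous (J δ) := by simp only [J]; fun_prop
      exact this.aestronglyMeasurable
    · have h1 : √(δ + x p) ≤ √(δ + (2 * G - 2 * GamInf γ)) :=
        sqrt_le_sqrt (add_le_add le_rfl (hxG p))
      have h2 := sqrt_nonneg (δ + x p)
      rw [Real.norm_eq_abs, abs_of_nonneg (by positivity)]
      simp only [J]
      gcongr
  · refine mul_le_mul_of_nonneg_right ?_ (exp_pos _).le
    simp only [qCoef]
    rw [hax]
    have h2 : 0 ≤ √(δ + x p) ^ 3 := by positivity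
    have := mul_le_mul_of_nonneg_right hε1 h2
    linarith

/-- At the right end of the interval the constant `g` is a subsolution of the Riccati equation. -/
lemma le_riccati_zero {g L : ℝ} (hg : 0 < g) (hL : 0 < L) (hγ : HolderC1 α γ)
    (hΓ : GamBounded γ) {ε : ℝ} (hε : 0 ≤ ε) :
    g ≤ riccati γ (g * L / π - 2 * GamInf γ) ((π / L) ^ 2) ε 0 := by
  have hκ : 0 < (π / L) ^ 2 := by positivity
  have hgL : 0 < g * L / π := by positivity
  have hlam : -2 * GamInf γ < g * L / π - 2 * GamInf γ := by linarith
  set lam := g * L / π - 2 * GamInf γ with hlamdef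
  have ha := (uniformlyPositive_aExt hγ hΓ hlam)
  have hconst : IsRiccati (fun p => aExt γ lam p ^ 3) (fun p => g ^ 2 / aExt γ lam p ^ 3)
      fun _ => g := ⟨fun p => by simpa using hasDerivAt_const p g, UniformlyPositive.const hg⟩
  refine IsRiccati.mono (ha.pow 3) (ha.pow 3) hconst
    (isRiccati_riccati hγ hΓ hlam hκ.le hε (by linarith)) (fun _ _ => le_rfl) (fun p _ => ?_) 0
    le_rfl
  have hap := ha.pos p
  have h1 : g * L / π ≤ aExt γ lam p ^ 2 := by
    rw [aExt_sq hΓ hlam]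
    linarith [GamInf_le hΓ (min_le_right p 0)]
  have h2 : g ≤ π / L * aExt γ lam p ^ 2 := by
    calc g = π / L * (g * L / π) := by field_simp
      _ ≤ _ := by gcongr
  have h3 : g ^ 2 / aExt γ lam p ^ 3 ≤ (π / L) ^ 2 * aExt γ lam p := by
    rw [div_le_iff₀ (by positivity)]
    calc g ^ 2 ≤ (π / L * aExt γ lam p ^ 2) ^ 2 := by gcongr
      _ = _ := by ring
  have h4 : 0 ≤ ε * aExt γ lam p ^ 3 := by positivity
  simp only [qCoef]
  linarith

lemma exists_riccati_zero_eq {g L : ℝ} (hg : 0 < g) (hL : 0 < L) (hγ : HolderC1 α γ)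
    (hΓ : GamBounded γ) (hbif : BifurcationCondition g L γ) {ε : ℝ} (hε : 0 ≤ ε) (hε1 : ε ≤ 1) :
    ∃ lam ∈ Ioc (-2 * GamInf γ) (g * L / π - 2 * GamInf γ),
      riccati γ lam ((π / L) ^ 2) ε 0 = g := by
  have hκ : 0 < (π / L) ^ 2 := by positivity
  have hgL : 0 < g * L / π := by positivity
  obtain ⟨δ, hδg, hδ0, hδ1⟩ := ((eventually_riccati_zero_lt hL hγ hΓ hbif hε hε1).and
    (Ioc_mem_nhdsGT hgL)).exists
  have hle : -2 * GamInf γ + δ ≤ g * L / π - 2 * GamInf γ := by linarith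
  have hcont : ContinuousOn (fun μ => riccati γ μ ((π / L) ^ 2) ε 0)
      (Icc (-2 * GamInf γ + δ) (g * L / π - 2 * GamInf γ)) := fun μ hμ =>
    (continuousAt_riccati_zero_lam hγ hΓ (by linarith [hμ.1]) hκ hε).continuousWithinAt
  obtain ⟨lam, hlam, hval⟩ := intermediate_value_Icc hle hcont
    ⟨hδg.le, le_riccati_zero hg hL hγ hΓ hε⟩
  exact ⟨lam, ⟨by linarith [hlam.1], hlam.2⟩, hval⟩

end

/-! ### Bounded Hölder functions of one variable -/

/-- `f` is bounded on `s` and globally `α`-Hölder continuous there. -/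
structure HolderBdd (α : ℝ) (s : Set ℝ) (f : ℝ → ℝ) : Prop where
  bdd : ∃ C, ∀ x ∈ s, |f x| ≤ C
  holder : ∃ C, ∀ x ∈ s, ∀ y ∈ s, |f x - f y| ≤ C * |x - y| ^ α

namespace HolderBdd

variable {α : ℝ} {s : Set ℝ} {f h : ℝ → ℝ}

lemma const (α : ℝ) (s : Set ℝ) (c : ℝ) : HolderBdd α s fun _ => c :=
  ⟨⟨|c|, fun _ _ => le_rfl⟩, ⟨0, fun _ _ _ _ => by simp⟩⟩

lemma sub (hf : HolderBdd α s f) (hh : HolderBdd α s h) : HolderBdd α s fun x => f x - h x := by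
  obtain ⟨⟨A, hA⟩, ⟨B, hB⟩⟩ := hf
  obtain ⟨⟨A', hA'⟩, ⟨B', hB'⟩⟩ := hh
  refine ⟨⟨A + A', fun x hx => (abs_sub _ _).trans (add_le_add (hA x hx) (hA' x hx))⟩,
    ⟨B + B', fun x hx y hy => ?_⟩⟩
  have h1 : f x - h x - (f y - h y) = (f x - f y) - (h x - h y) := by ring
  rw [h1, add_mul]
  exact (abs_sub _ _).trans (add_le_add (hB x hx y hy) (hB' x hx y hy))

lemma mul (hf : HolderBdd α s f) (hh : HolderBdd α s h) : HolderBdd α s fun x => f x * h x := by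
  obtain ⟨⟨A, hA⟩, ⟨B, hB⟩⟩ := hf
  obtain ⟨⟨A', hA'⟩, ⟨B', hB'⟩⟩ := hh
  refine ⟨⟨A * A', fun x hx => ?_⟩, ⟨A * B' + A' * B, fun x hx y hy => ?_⟩⟩
  · rw [abs_mul]
    exact mul_le_mul (hA x hx) (hA' x hx) (abs_nonneg _) ((abs_nonneg _).trans (hA x hx))
  have h1 : f x * h x - f y * h y = f x * (h x - h y) + h y * (f x - f y) := by ring
  rw [h1, add_mul, mul_assoc, mul_assoc]
  refine (abs_add_le _ _).trans ?_
  rw [abs_mul, abs_mul]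
  exact add_le_add
    (mul_le_mul (hA x hx) (hB' x hx y hy) (abs_nonneg _) ((abs_nonneg _).trans (hA x hx)))
    (mul_le_mul (hA' y hy) (hB x hx y hy) (abs_nonneg _) ((abs_nonneg _).trans (hA' y hy)))

lemma add (hf : HolderBdd α s f) (hh : HolderBdd α s h) : HolderBdd α s fun x => f x + h x := by
  have := hf.sub ((const α s (-1)).mul hh)
  simpa using this

lemma of_hasDerivWithinAt {f' : ℝ → ℝ} (hs : Convex ℝ s) (hα₀ : 0 < α) (hα₁ : α < 1)
    (hf : ∀ x ∈ s, HasDerivWithinAt f (f' x) s x) (hb : ∃ C, ∀ x ∈ s, |f x| ≤ C)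
    (hb' : ∃ C, ∀ x ∈ s, |f' x| ≤ C) : HolderBdd α s f := by
  refine ⟨hb, ?_⟩
  obtain ⟨A, hA⟩ := hb
  obtain ⟨B, hB⟩ := hb'
  refine ⟨B + 2 * A, fun x hx y hy => ?_⟩
  have hA0 : 0 ≤ A := (abs_nonneg _).trans (hA x hx)
  have hB0 : 0 ≤ B := (abs_nonneg _).trans (hB x hx)
  have hpow : 0 ≤ |x - y| ^ α := rpow_nonneg (abs_nonneg _) _
  rcases le_total |x - y| 1 with h1 | h1
  · have h2 : |f x - f y| ≤ B * |x - y| :=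
      hs.norm_image_sub_le_of_norm_hasDerivWithin_le hf hB hy hx
    have h3 : |x - y| ≤ |x - y| ^ α := self_le_rpow_of_le_one (abs_nonneg _) h1 hα₁.le
    nlinarith [mul_le_mul_of_nonneg_left h3 hB0, mul_nonneg hA0 hpow]
  · have h2 : |f x - f y| ≤ 2 * A := by
      linarith [abs_sub (f x) (f y), hA x hx, hA y hy]
    have h3 : 1 ≤ |x - y| ^ α := one_le_rpow h1 hα₀.le
    nlinarith [mul_nonneg hA0 (sub_nonneg.2 h3), mul_nonneg hB0 hpow]

lemma continuousOn (hα₀ : 0 < α) (hf : HolderBdd α s f) : ContinuousOn f s := by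
  obtain ⟨B, hB⟩ := hf.holder
  intro x hx
  rw [ContinuousWithinAt, tendsto_iff_norm_sub_tendsto_zero]
  have hlim : Tendsto (fun y => B * |y - x| ^ α) (𝓝[s] x) (𝓝 0) := by
    have : Continuous fun y : ℝ => B * |y - x| ^ α :=
      continuous_const.mul ((continuous_id.sub continuous_const).abs.rpow_const
        fun _ => Or.inr hα₀.le)
    simpa [zero_rpow hα₀.ne'] using (this.tendsto x).mono_left nhdsWithin_le_nhds
  refine squeeze_zero' (Eventually.of_forall fun _ => norm_nonneg _) ?_ hlim
  filter_upwards [self_mem_nhdsWithin] with y hy using hB y hy x hx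

end HolderBdd

/-! ### Functions with separated variables -/

lemma iterate_deriv_cos (L : ℝ) (k : ℕ) :
    deriv^[k] (fun q => cos (π * q / L))
      = fun q => (π / L) ^ k * cos (π * q / L + k * (π / 2)) := by
  induction k with
  | zero => simp
  | succ k ih =>
    rw [Function.iterate_succ_apply', ih]
    funext q
    have h1 : HasDerivAt (fun q : ℝ => π * q / L + k * (π / 2)) (π * 1 / L) q :=
      (((hasDerivAt_id q).const_mul π).div_const L).add_const _
    rw [(h1.cos.const_mul ((π / L) ^ k)).deriv]
    have h2 : π * q / L + ((k + 1 : ℕ) : ℝ) * (π / 2) = π * q / L + k * (π / 2) + π / 2 := by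
      push_cast; ring
    rw [h2, cos_add_pi_div_two]
    ring

lemma hasDerivAt_iterate_deriv_cos (L : ℝ) (k : ℕ) (q : ℝ) :
    HasDerivAt (deriv^[k] fun q => cos (π * q / L))
      ((deriv^[k + 1] fun q => cos (π * q / L)) q) q := by
  rw [Function.iterate_succ_apply', hasDerivAt_deriv_iff, iterate_deriv_cos]
  fun_prop

lemma abs_iterate_deriv_cos_le {L : ℝ} (hL : 0 < L) (k : ℕ) (q : ℝ) :
    |(deriv^[k] fun q => cos (π * q / L)) q| ≤ (π / L) ^ k := by
  rw [iterate_deriv_cos, abs_mul, abs_of_nonneg (by positivity)]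
  exact mul_le_of_le_one_right (by positivity) (abs_cos_le_one _)

lemma holderBdd_iterate_deriv_cos {L α : ℝ} (hL : 0 < L) (hα₀ : 0 < α) (hα₁ : α < 1) (k : ℕ) :
    HolderBdd α univ (deriv^[k] fun q => cos (π * q / L)) :=
  .of_hasDerivWithinAt convex_univ hα₀ hα₁
    (fun q _ => (hasDerivAt_iterate_deriv_cos L k q).hasDerivWithinAt)
    ⟨_, fun q _ => abs_iterate_deriv_cos_le hL k q⟩
    ⟨_, fun q _ => abs_iterate_deriv_cos_le hL (k + 1) q⟩

lemma mixedPartial_firstMode (L : ℝ) (v : ℝ → ℝ) (k₁ k₂ : ℕ) (q p : ℝ) :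
    mixedPartial k₁ k₂ (firstMode L v) q p
      = ((fun u => derivWithin u (Iic 0))^[k₂] v) p * (deriv^[k₁] fun q => cos (π * q / L)) q := by
  have h1 : partialQ^[k₁] (firstMode L v)
      = fun q p => v p * (deriv^[k₁] fun q => cos (π * q / L)) q := by
    induction k₁ with
    | zero => rfl
    | succ k ih =>
      rw [Function.iterate_succ_apply', ih]
      funext q p
      rw [partialQ, deriv_const_mul_field, Function.iterate_succ_apply']
  have h2 : partialP^[k₂] (fun q p => v p * (deriv^[k₁] fun q => cos (π * q / L)) q)
      = fun q p => ((fun u => derivWithin u (Iic 0))^[k₂] v) p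
          * (deriv^[k₁] fun q => cos (π * q / L)) q := by
    induction k₂ with
    | zero => rfl
    | succ k ih =>
      rw [Function.iterate_succ_apply', ih]
      funext q p
      rw [partialP, derivWithin_mul_const_field, Function.iterate_succ_apply']
  rw [mixedPartial, h1, h2]

lemma eqOn_iterate_derivWithin {F : ℕ → ℝ → ℝ} {n : ℕ}
    (hF : ∀ k < n, ∀ p ≤ 0, HasDerivWithinAt (F k) (F (k + 1) p) (Iic 0) p) :
    ∀ k ≤ n, EqOn ((fun u => derivWithin u (Iic 0))^[k] (F 0)) (F k) (Iic 0) := by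
  intro k
  induction k with
  | zero => exact fun _ _ _ => rfl
  | succ k ih =>
    intro hk p hp
    rw [Function.iterate_succ_apply']
    have h1 := ih (Nat.le_of_succ_le hk)
    change derivWithin _ (Iic 0) p = _
    rw [derivWithin_congr h1 (h1 hp)]
    exact (hF k hk p hp).derivWithin (uniqueDiffOn_Iic 0 p hp)

/-- A criterion for `v(p) cos(πq/L)` to belong to `X`, in terms of the derivatives of `v`. -/
lemma memX_firstMode {L α : ℝ} (hL : 0 < L) (hα₀ : 0 < α) (hα₁ : α < 1) {F : ℕ → ℝ → ℝ}
    (hF : ∀ k < 3, ∀ p ≤ 0, HasDerivWithinAt (F k) (F (k + 1) p) (Iic 0) p)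
    (hH : ∀ k ≤ 3, HolderBdd α (Iic 0) (F k)) (hlim : ∀ k ≤ 3, Tendsto (F k) atBot (𝓝 0)) :
    MemX L α (firstMode L (F 0)) := by
  have heq := eqOn_iterate_derivWithin hF
  have hmix : ∀ k₁ k₂, k₂ ≤ 3 → ∀ q p, p ≤ 0 → mixedPartial k₁ k₂ (firstMode L (F 0)) q p
      = F k₂ p * (deriv^[k₁] fun q => cos (π * q / L)) q := fun k₁ k₂ hk q p hp => by
    rw [mixedPartial_firstMode, heq k₂ hk hp]
  refine ⟨⟨?_, fun q p _ => ?_, fun q p _ => ?_, fun k₁ k₂ hk => ?_, fun k₁ k₂ hk => ?_⟩,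
    fun k₁ k₂ hk => ?_⟩
  · have h1 : ContDiffOn ℝ 3 (F 0) (Iic 0) := by
      refine contDiffOn_of_continuousOn_differentiableOn_deriv (n := 3) ?_ ?_
      · intro m hm
        have hm : m ≤ 3 := by exact_mod_cast hm
        simp only [iteratedDerivWithin_eq_iterate]
        exact ((hH m hm).continuousOn hα₀).congr (heq m hm)
      · intro m hm
        have hm : m < 3 := by exact_mod_cast hm
        simp only [iteratedDerivWithin_eq_iterate]
        exact DifferentiableOn.congr
          (fun p hp => (hF m hm p hp).differentiableWithinAt) (heq m hm.le)
    have h2 : ContDiffOn ℝ 3 (fun z : ℝ × ℝ => F 0 z.2) (univ ×ˢ Iic 0) :=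
      h1.comp contDiff_snd.contDiffOn fun z hz => hz.2
    have h3 : ContDiff ℝ 3 fun z : ℝ × ℝ => cos (π * z.1 / L) := by fun_prop
    exact h2.mul h3.contDiffOn
  · simp [firstMode, neg_div]
  · have : π * (q + 2 * L) / L = π * q / L + 2 * π := by field_simp
    simp only [firstMode]
    rw [this, cos_add_two_pi]
  · obtain ⟨C, hC⟩ := (hH k₂ (by omega)).bdd
    refine ⟨C * (π / L) ^ k₁, fun q p hp => ?_⟩
    rw [hmix k₁ k₂ (by omega) q p hp, abs_mul]
    exact mul_le_mul (hC p hp) (abs_iterate_deriv_cos_le hL k₁ q) (abs_nonneg _)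
      ((abs_nonneg _).trans (hC p hp))
  · obtain ⟨⟨A, hA⟩, ⟨B, hB⟩⟩ := hH k₂ (by omega)
    obtain ⟨⟨A', hA'⟩, ⟨B', hB'⟩⟩ := holderBdd_iterate_deriv_cos hL hα₀ hα₁ k₁
    set t := deriv^[k₁] fun q => cos (π * q / L)
    have hA0 : 0 ≤ A := (abs_nonneg _).trans (hA 0 self_mem_Iic)
    have hA0' : 0 ≤ A' := (abs_nonneg _).trans (hA' 0 trivial)
    have hB0 : 0 ≤ B := by
      have := (abs_nonneg _).trans (hB 0 self_mem_Iic (-1) (by norm_num))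
      simpa using this
    have hB0' : 0 ≤ B' := by
      have := (abs_nonneg _).trans (hB' 1 trivial 0 trivial)
      simpa using this
    refine ⟨A * B' + A' * B, fun q p q' p' hp hp' => ?_⟩
    rw [hmix k₁ k₂ (by omega) q p hp, hmix k₁ k₂ (by omega) q' p' hp']
    have hpow : ∀ x y : ℝ, |x| ^ α ≤ (x ^ 2 + y ^ 2) ^ (α / 2) := fun x y => by
      have h1 : |x| ^ α = (x ^ 2) ^ (α / 2) := by
        rw [← sq_abs, ← rpow_natCast, ← rpow_mul (abs_nonneg _)]
        congr 1
        push_cast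
        ring
      rw [h1]
      exact rpow_le_rpow (sq_nonneg _) (by nlinarith [sq_nonneg y]) (by linarith)
    have h1 := hpow (q - q') (p - p')
    have h2 := hpow (p - p') (q - q')
    rw [add_comm] at h2
    set S := ((q - q') ^ 2 + (p - p') ^ 2) ^ (α / 2)
    have h3 : F k₂ p * t q - F k₂ p' * t q'
        = F k₂ p * (t q - t q') + t q' * (F k₂ p - F k₂ p') := by ring
    rw [h3, add_mul, mul_assoc, mul_assoc]
    refine (abs_add_le _ _).trans ?_
    rw [abs_mul, abs_mul]
    exact add_le_add
      (mul_le_mul (hA p hp) ((hB' q trivial q' trivial).trans (mul_le_mul_of_nonneg_left h1 hB0'))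
        (abs_nonneg _) hA0)
      (mul_le_mul (hA' q' trivial) ((hB p hp p' hp').trans (mul_le_mul_of_nonneg_left h2 hB0))
        (abs_nonneg _) hA0')
  · rw [Metric.tendstoUniformly_iff]
    intro e he
    have h1 : Tendsto (fun p => |F k₂ p| * (π / L) ^ k₁) atBot (𝓝 0) := by
      simpa using (hlim k₂ (by omega)).abs.mul_const ((π / L) ^ k₁)
    filter_upwards [h1.eventually (gt_mem_nhds he), eventually_le_atBot 0] with p hp hp0 q
    rw [hmix k₁ k₂ (by omega) q p hp0, dist_comm, dist_zero_right, norm_mul]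
    exact (mul_le_mul_of_nonneg_left (abs_iterate_deriv_cos_le hL k₁ q) (abs_nonneg _)).trans_lt hp

/-! ### The positive eigenfunction -/

/-- The positive decaying solution `exp ∫₀ᵖ w / a³` of `(a³ v')' = (κ a + ε a³) v`. -/
noncomputable def modeFun (γ : ℝ → ℝ) (lam κ ε p : ℝ) : ℝ :=
  exp (∫ s in (0 : ℝ)..p, riccati γ lam κ ε s / aExt γ lam s ^ 3)

/-- The derivative of `modeFun`. -/
noncomputable def modeDeriv₁ (γ : ℝ → ℝ) (lam κ ε p : ℝ) : ℝ :=
  riccati γ lam κ ε p / aExt γ lam p ^ 3 * modeFun γ lam κ ε p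

/-- The second derivative of `modeFun` on `(-∞, 0]`, from the equation
`v'' = (κ / a² + ε) v - 3 (γ(-p) / a²) v'`. -/
noncomputable def modeDeriv₂ (γ : ℝ → ℝ) (lam κ ε p : ℝ) : ℝ :=
  (κ * (aExt γ lam p ^ 2)⁻¹ + ε) * modeFun γ lam κ ε p
    - 3 * (γ (-p) * (aExt γ lam p ^ 2)⁻¹) * modeDeriv₁ γ lam κ ε p

/-- The third derivative of `modeFun` on `(-∞, 0]`; here `(1 / a²)' = -2 γ(-p) / a⁴`. -/
noncomputable def modeDeriv₃ (γ : ℝ → ℝ) (lam κ ε p : ℝ) : ℝ :=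
  (κ * (-2 * γ (-p) * ((aExt γ lam p ^ 2)⁻¹ * (aExt γ lam p ^ 2)⁻¹))) * modeFun γ lam κ ε p
    + (κ * (aExt γ lam p ^ 2)⁻¹ + ε) * modeDeriv₁ γ lam κ ε p
    - (3 * (-derivWithin γ (Ici 0) (-p) * (aExt γ lam p ^ 2)⁻¹
        + γ (-p) * (-2 * γ (-p) * ((aExt γ lam p ^ 2)⁻¹ * (aExt γ lam p ^ 2)⁻¹)))
        * modeDeriv₁ γ lam κ ε p
      + 3 * (γ (-p) * (aExt γ lam p ^ 2)⁻¹) * modeDeriv₂ γ lam κ ε p)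

/-- `modeFun` and its derivatives up to order three on `(-∞, 0]`, indexed by the order. -/
noncomputable def modeDeriv (γ : ℝ → ℝ) (lam κ ε : ℝ) : ℕ → ℝ → ℝ
  | 0 => modeFun γ lam κ ε
  | 1 => modeDeriv₁ γ lam κ ε
  | 2 => modeDeriv₂ γ lam κ ε
  | _ => modeDeriv₃ γ lam κ ε

lemma modeFun_pos (γ : ℝ → ℝ) (lam κ ε p : ℝ) : 0 < modeFun γ lam κ ε p := exp_pos _

section

variable {α : ℝ} {γ : ℝ → ℝ} {lam κ ε : ℝ}

lemma hasDerivAt_modeFun (hγ : HolderC1 α γ) (hΓ : GamBounded γ) (hlam : -2 * GamInf γ < lam)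
    (hκ : 0 ≤ κ) (hε : 0 ≤ ε) (hκε : 0 < κ + ε) (p : ℝ) :
    HasDerivAt (modeFun γ lam κ ε) (modeDeriv γ lam κ ε 1 p) p := by
  have hw := ((isRiccati_riccati hγ hΓ hlam hκ hε hκε).uniformlyPositive.div
    ((uniformlyPositive_aExt hγ hΓ hlam).pow 3)).continuous
  have h1 := (intervalIntegral.integral_hasDerivAt_right (hw.intervalIntegrable 0 p)
    (hw.stronglyMeasurableAtFilter _ _) hw.continuousAt).exp
  refine h1.congr_deriv ?_
  rw [mul_comm]
  rfl

lemma modeFun_le_exp (hγ : HolderC1 α γ) (hΓ : GamBounded γ) (hlam : -2 * GamInf γ < lam)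
    (hκ : 0 ≤ κ) (hε : 0 ≤ ε) (hκε : 0 < κ + ε) :
    ∃ σ, 0 < σ ∧ ∀ p ≤ 0, modeFun γ lam κ ε p ≤ exp (σ * p) := by
  have hw := (isRiccati_riccati hγ hΓ hlam hκ hε hκε).uniformlyPositive.div
    ((uniformlyPositive_aExt hγ hΓ hlam).pow 3)
  obtain ⟨l, u, hl, hb⟩ := hw.bounds
  refine ⟨l, hl, fun p hp => exp_le_exp.2 ?_⟩
  have h1 := intervalIntegral.integral_mono_on (μ := volume) (a := p) (b := 0) hp
    (f := fun _ => l) (by simp) (hw.continuous.intervalIntegrable _ _) (fun p _ => (hb p).1)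
  rw [intervalIntegral.integral_const, smul_eq_mul] at h1
  rw [intervalIntegral.integral_symm]
  linarith

lemma hasDerivWithinAt_sq_aExt (hγ : HolderC1 α γ) (hΓ : GamBounded γ)
    (hlam : -2 * GamInf γ < lam) {p : ℝ} (hp : p ≤ 0) :
    HasDerivWithinAt (fun p => aExt γ lam p ^ 2) (2 * γ (-p)) (Iic 0) p := by
  have h1 : ∀ q ∈ Iic (0 : ℝ), aExt γ lam q ^ 2 = lam + 2 * Gam γ q := fun q hq => by
    rw [aExt_sq hΓ hlam, min_eq_left (show q ≤ 0 from hq)]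
  exact (((hasDerivWithinAt_Gam hγ hp).const_mul 2).const_add lam).congr h1 (h1 p hp)

lemma hasDerivWithinAt_cube_aExt (hγ : HolderC1 α γ) (hΓ : GamBounded γ)
    (hlam : -2 * GamInf γ < lam) {p : ℝ} (hp : p ≤ 0) :
    HasDerivWithinAt (fun p => aExt γ lam p ^ 3) (3 * aExt γ lam p * γ (-p)) (Iic 0) p := by
  have hpos := (uniformlyPositive_aExt hγ hΓ hlam).pos
  have h1 := hasDerivWithinAt_sq_aExt hγ hΓ hlam hp
  have h2 := h1.sqrt (pow_pos (hpos p) 2).ne'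
  simp only [sqrt_sq (hpos _).le] at h2
  refine (h2.pow 3).congr_deriv ?_
  have := hpos p
  field_simp
  norm_num
  ring

lemma hasDerivWithinAt_inv_sq_aExt (hγ : HolderC1 α γ) (hΓ : GamBounded γ)
    (hlam : -2 * GamInf γ < lam) {p : ℝ} (hp : p ≤ 0) :
    HasDerivWithinAt (fun p => (aExt γ lam p ^ 2)⁻¹)
      (-2 * γ (-p) * ((aExt γ lam p ^ 2)⁻¹ * (aExt γ lam p ^ 2)⁻¹)) (Iic 0) p := by
  have hpos := (uniformlyPositive_aExt hγ hΓ hlam).pos p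
  refine ((hasDerivWithinAt_sq_aExt hγ hΓ hlam hp).inv (pow_pos hpos 2).ne').congr_deriv ?_
  field_simp

lemma hasDerivWithinAt_vorticity (hγ : HolderC1 α γ) {p : ℝ} (hp : p ≤ 0) :
    HasDerivWithinAt (fun p => γ (-p)) (-derivWithin γ (Ici 0) (-p)) (Iic 0) p := by
  have h1 : HasDerivWithinAt γ (derivWithin γ (Ici 0) (-p)) (Ici 0) (-p) :=
    (hγ.contDiffOn.differentiableOn one_ne_zero (-p) (by simpa using hp)).hasDerivWithinAt
  have h2 := h1.comp p (hasDerivAt_neg p).hasDerivWithinAt (s := Iic 0)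
    (fun q hq => by simpa using hq)
  exact h2.congr_deriv (by ring)

lemma hasDerivWithinAt_modeDeriv (hγ : HolderC1 α γ) (hΓ : GamBounded γ)
    (hlam : -2 * GamInf γ < lam) (hκ : 0 ≤ κ) (hε : 0 ≤ ε) (hκε : 0 < κ + ε) :
    ∀ k < 3, ∀ p ≤ 0, HasDerivWithinAt (modeDeriv γ lam κ ε k) (modeDeriv γ lam κ ε (k + 1) p)
      (Iic 0) p := by
  have h0 : ∀ p, HasDerivWithinAt (modeFun γ lam κ ε) (modeDeriv γ lam κ ε 1 p) (Iic 0) p :=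
    fun p => (hasDerivAt_modeFun hγ hΓ hlam hκ hε hκε p).hasDerivWithinAt
  have h1 : ∀ p ≤ 0, HasDerivWithinAt (modeDeriv γ lam κ ε 1) (modeDeriv γ lam κ ε 2 p)
      (Iic 0) p := fun p hp => by
    have hpos := (uniformlyPositive_aExt hγ hΓ hlam).pos p
    have hw := ((isRiccati_riccati hγ hΓ hlam hκ hε hκε).hasDerivAt p).hasDerivWithinAt
      (s := Iic 0)
    refine ((hw.div (hasDerivWithinAt_cube_aExt hγ hΓ hlam hp) (pow_pos hpos 3).ne').mul
      (h0 p)).congr_deriv ?_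
    simp only [modeDeriv, modeDeriv₁, modeDeriv₂, qCoef, Pi.div_apply]
    field_simp
    ring
  intro k hk p hp
  have hr := hasDerivWithinAt_inv_sq_aExt hγ hΓ hlam hp
  have hc := hasDerivWithinAt_vorticity hγ hp
  interval_cases k
  · exact h0 p
  · exact h1 p hp
  · exact (((hr.const_mul κ).add_const ε).mul (h0 p)).sub (((hc.mul hr).const_mul 3).mul (h1 p hp))

/-- All the derivatives up to order three are bounded by a multiple of the function itself. -/
lemma exists_abs_modeDeriv_le (hγ : HolderC1 α γ) (hΓ : GamBounded γ)
    (hlam : -2 * GamInf γ < lam) (hκ : 0 ≤ κ) (hε : 0 ≤ ε) (hκε : 0 < κ + ε) :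
    ∀ k ≤ 3, ∃ C, ∀ p ≤ 0, |modeDeriv γ lam κ ε k p| ≤ C * modeFun γ lam κ ε p := by
  have ha := uniformlyPositive_aExt hγ hΓ hlam
  have hbdd : ∀ {f}, UniformlyPositive f → ∃ C, ∀ p, |f p| ≤ C := fun {f} hf => by
    obtain ⟨l, u, hl, hb⟩ := hf.bounds
    exact ⟨u, fun p => by rw [abs_of_pos (hf.pos p)]; exact (hb p).2⟩
  obtain ⟨W, hW⟩ := hbdd ((isRiccati_riccati hγ hΓ hlam hκ hε hκε).uniformlyPositive.div (ha.pow 3))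
  obtain ⟨R, hR⟩ := hbdd (ha.pow 2).inv
  obtain ⟨G, hG⟩ := hγ.bounded
  obtain ⟨G', hG'⟩ := hγ.bounded_deriv
  set v := modeFun γ lam κ ε with hv
  have hvpos : ∀ p, 0 < v p := modeFun_pos γ lam κ ε
  have hmul : ∀ {f h : ℝ → ℝ}, (∃ A, ∀ p ≤ 0, |f p| ≤ A) → (∃ B, ∀ p ≤ 0, |h p| ≤ B * v p) →
      ∃ C, ∀ p ≤ 0, |f p * h p| ≤ C * v p := by
    rintro f h ⟨A, hA⟩ ⟨B, hB⟩
    refine ⟨A * B, fun p hp => ?_⟩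
    rw [abs_mul, mul_assoc]
    exact mul_le_mul (hA p hp) (hB p hp) (abs_nonneg _) ((abs_nonneg _).trans (hA p hp))
  have hadd : ∀ {f h : ℝ → ℝ}, (∃ A, ∀ p ≤ 0, |f p| ≤ A * v p) →
      (∃ B, ∀ p ≤ 0, |h p| ≤ B * v p) → ∃ C, ∀ p ≤ 0, |f p + h p| ≤ C * v p := by
    rintro f h ⟨A, hA⟩ ⟨B, hB⟩
    exact ⟨A + B, fun p hp => by
      rw [add_mul]; exact (abs_add_le _ _).trans (add_le_add (hA p hp) (hB p hp))⟩
  have hsub : ∀ {f h : ℝ → ℝ}, (∃ A, ∀ p ≤ 0, |f p| ≤ A * v p) →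
      (∃ B, ∀ p ≤ 0, |h p| ≤ B * v p) → ∃ C, ∀ p ≤ 0, |f p - h p| ≤ C * v p := by
    rintro f h ⟨A, hA⟩ ⟨B, hB⟩
    exact ⟨A + B, fun p hp => by
      rw [add_mul]; exact (abs_sub _ _).trans (add_le_add (hA p hp) (hB p hp))⟩
  have hb_mul : ∀ {f h : ℝ → ℝ}, (∃ A, ∀ p ≤ 0, |f p| ≤ A) → (∃ B, ∀ p ≤ 0, |h p| ≤ B) →
      ∃ C, ∀ p ≤ 0, |f p * h p| ≤ C := by
    rintro f h ⟨A, hA⟩ ⟨B, hB⟩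
    refine ⟨A * B, fun p hp => ?_⟩
    rw [abs_mul]
    exact mul_le_mul (hA p hp) (hB p hp) (abs_nonneg _) ((abs_nonneg _).trans (hA p hp))
  have hb_add : ∀ {f h : ℝ → ℝ}, (∃ A, ∀ p ≤ 0, |f p| ≤ A) → (∃ B, ∀ p ≤ 0, |h p| ≤ B) →
      ∃ C, ∀ p ≤ 0, |f p + h p| ≤ C := by
    rintro f h ⟨A, hA⟩ ⟨B, hB⟩
    exact ⟨A + B, fun p hp => (abs_add_le _ _).trans (add_le_add (hA p hp) (hB p hp))⟩
  have hconst : ∀ x : ℝ, ∃ A, ∀ p ≤ (0 : ℝ), |(fun _ : ℝ => x) p| ≤ A :=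
    fun x => ⟨|x|, fun _ _ => le_rfl⟩
  have hr : ∃ A, ∀ p ≤ 0, |(aExt γ lam p ^ 2)⁻¹| ≤ A := ⟨R, fun p _ => hR p⟩
  have hc : ∃ A, ∀ p ≤ 0, |γ (-p)| ≤ A := ⟨G, fun p hp => hG (-p) (by linarith)⟩
  have hc' : ∃ A, ∀ p ≤ 0, |-derivWithin γ (Ici 0) (-p)| ≤ A :=
    ⟨G', fun p hp => by rw [abs_neg]; exact hG' (-p) (by linarith)⟩
  have h0 : ∃ C, ∀ p ≤ 0, |v p| ≤ C * v p :=
    ⟨1, fun p _ => by rw [one_mul, abs_of_pos (hvpos p)]⟩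
  have h1 : ∃ C, ∀ p ≤ 0, |modeDeriv γ lam κ ε 1 p| ≤ C * v p := hmul ⟨W, fun p _ => hW p⟩ h0
  have hr' := hb_mul (hb_mul (hconst (-2)) hc) (hb_mul hr hr)
  have hA := hb_add (hb_mul (hconst κ) hr) (hconst ε)
  have hB := hb_mul (hconst 3) (hb_mul hc hr)
  have h2 : ∃ C, ∀ p ≤ 0, |modeDeriv γ lam κ ε 2 p| ≤ C * v p := hsub (hmul hA h0) (hmul hB h1)
  intro k hk
  interval_cases k
  · exact h0
  · exact h1
  · exact h2
  · exact hsub (hadd (hmul (hb_mul (hconst κ) hr') h0) (hmul hA h1))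
      (hadd (hmul (hb_mul (hconst 3) (hb_add (hb_mul hc' hr) (hb_mul hc hr'))) h1) (hmul hB h2))

lemma memX_modeFun {L : ℝ} (hL : 0 < L) (hα₀ : 0 < α) (hα₁ : α < 1) (hγ : HolderC1 α γ)
    (hΓ : GamBounded γ) (hlam : -2 * GamInf γ < lam) (hκ : 0 ≤ κ) (hε : 0 ≤ ε)
    (hκε : 0 < κ + ε) : MemX L α (firstMode L (modeFun γ lam κ ε)) := by
  have hd := hasDerivWithinAt_modeDeriv hγ hΓ hlam hκ hε hκε
  have hle := exists_abs_modeDeriv_le hγ hΓ hlam hκ hε hκε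
  obtain ⟨σ, hσ, hexp⟩ := modeFun_le_exp hγ hΓ hlam hκ hε hκε
  have hbd : ∀ k ≤ 3, ∃ C, ∀ p ≤ 0, |modeDeriv γ lam κ ε k p| ≤ C * exp (σ * p) := fun k hk => by
    obtain ⟨C, hC⟩ := hle k hk
    have hC0 : 0 ≤ C := nonneg_of_mul_nonneg_left ((abs_nonneg _).trans (hC 0 le_rfl))
      (modeFun_pos γ lam κ ε 0)
    exact ⟨C, fun p hp => (hC p hp).trans (mul_le_mul_of_nonneg_left (hexp p hp) hC0)⟩
  have hbdd : ∀ k ≤ 3, ∃ C, ∀ p ∈ Iic (0 : ℝ), |modeDeriv γ lam κ ε k p| ≤ C := fun k hk => by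
    obtain ⟨C, hC⟩ := hbd k hk
    have hC0 : 0 ≤ C := nonneg_of_mul_nonneg_left ((abs_nonneg _).trans (hC 0 le_rfl)) (exp_pos _)
    refine ⟨C, fun p hp => (hC p hp).trans (mul_le_of_le_one_right hC0 (exp_le_one_iff.2 ?_))⟩
    exact mul_nonpos_of_nonneg_of_nonpos hσ.le hp
  have hH : ∀ k < 3, HolderBdd α (Iic 0) (modeDeriv γ lam κ ε k) := fun k hk =>
    .of_hasDerivWithinAt (convex_Iic 0) hα₀ hα₁ (hd k hk) (hbdd k hk.le) (hbdd (k + 1) hk)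
  have ha := uniformlyPositive_aExt hγ hΓ hlam
  obtain ⟨G, hG⟩ := hγ.bounded
  obtain ⟨G', hG'⟩ := hγ.bounded_deriv
  obtain ⟨l, R, _, hR⟩ := (ha.pow 2).inv.bounds
  have hcb : ∀ p ∈ Iic (0 : ℝ), |γ (-p)| ≤ G := fun p hp => hG (-p) (neg_nonneg.2 hp)
  have hrb : ∀ p, |(aExt γ lam p ^ 2)⁻¹| ≤ R := fun p => by
    rw [abs_of_pos ((ha.pow 2).inv.pos p)]; exact (hR p).2
  have hr : HolderBdd α (Iic 0) fun p => (aExt γ lam p ^ 2)⁻¹ :=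
    .of_hasDerivWithinAt (convex_Iic 0) hα₀ hα₁
      (fun p hp => hasDerivWithinAt_inv_sq_aExt hγ hΓ hlam hp) ⟨R, fun p _ => hrb p⟩
      ⟨2 * G * (R * R), fun p hp => by
        rw [abs_mul, abs_mul, abs_mul, abs_neg, abs_two]
        have h1 := hcb p hp
        have h2 := hrb p
        have h3 : 0 ≤ G := (abs_nonneg _).trans h1
        have h4 : 0 ≤ R := (abs_nonneg _).trans h2
        gcongr⟩
  have hc : HolderBdd α (Iic 0) fun p => γ (-p) :=
    .of_hasDerivWithinAt (convex_Iic 0) hα₀ hα₁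
      (fun p hp => hasDerivWithinAt_vorticity hγ hp) ⟨G, hcb⟩
      ⟨G', fun p hp => by rw [abs_neg]; exact hG' (-p) (neg_nonneg.2 hp)⟩
  have hc' : HolderBdd α (Iic 0) fun p => -derivWithin γ (Ici 0) (-p) := by
    obtain ⟨C, hC⟩ := hγ.holder_deriv
    refine ⟨⟨G', fun p hp => by rw [abs_neg]; exact hG' (-p) (neg_nonneg.2 hp)⟩, C,
      fun p hp p' hp' => ?_⟩
    have h1 := hC (-p) (-p') (neg_nonneg.2 hp) (neg_nonneg.2 hp')
    rw [abs_sub_comm, abs_sub_comm (-p)] at h1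
    convert h1 using 2
    · ring_nf
    · ring_nf
  have hr' := ((HolderBdd.const α (Iic 0) (-2)).mul hc).mul (hr.mul hr)
  have hA := ((HolderBdd.const α (Iic 0) κ).mul hr).add (.const α (Iic 0) ε)
  have hB := (HolderBdd.const α (Iic 0) 3).mul (hc.mul hr)
  have h3 : HolderBdd α (Iic 0) (modeDeriv γ lam κ ε 3) :=
    ((((HolderBdd.const α (Iic 0) κ).mul hr').mul (hH 0 (by norm_num))).add
      (hA.mul (hH 1 (by norm_num)))).sub
    ((((HolderBdd.const α (Iic 0) 3).mul ((hc'.mul hr).add (hc.mul hr'))).mul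
      (hH 1 (by norm_num))).add (hB.mul (hH 2 (by norm_num))))
  refine memX_firstMode hL hα₀ hα₁ (F := modeDeriv γ lam κ ε) hd (fun k hk => ?_) fun k hk => ?_
  · rcases hk.lt_or_eq with hk | rfl
    · exact hH k hk
    · exact h3
  · obtain ⟨C, hC⟩ := hbd k hk
    have hlim : Tendsto (fun p => C * exp (σ * p)) atBot (𝓝 0) := by
      simpa using (tendsto_exp_atBot.comp (tendsto_id.const_mul_atBot hσ)).const_mul C
    refine squeeze_zero_norm' ?_ hlim
    filter_upwards [eventually_le_atBot 0] with p hp using hC p hp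

lemma lam_rpow_eq (hΓ : GamBounded γ) (hlam : -2 * GamInf γ < lam) :
    lam ^ (3 / 2 : ℝ) = aExt γ lam 0 ^ 3 := by
  have h1 : 0 ≤ lam := by linarith [GamInf_nonpos hΓ]
  rw [rpow_div_two_eq_sqrt 3 h1, aExt, aCoef, min_self, Gam_zero]
  norm_num

/-- If `w(0) = g`, then `exp (∫₀ᵖ w / a³) cos(πq/L)` solves the linearized problem. -/
lemma isEigenSolution_modeFun {g L : ℝ} (hL : 0 < L) (hα₀ : 0 < α) (hα₁ : α < 1)
    (hγ : HolderC1 α γ) (hΓ : GamBounded γ) (hlam : -2 * GamInf γ < lam) (hε : 0 ≤ ε)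
    (hw0 : riccati γ lam ((π / L) ^ 2) ε 0 = g) :
    IsEigenSolution g L α γ ε lam (firstMode L (modeFun γ lam ((π / L) ^ 2) ε)) := by
  have hκ : 0 < (π / L) ^ 2 := by positivity
  set κ := (π / L) ^ 2 with hκdef
  have hpos := (uniformlyPositive_aExt hγ hΓ hlam).pos
  have hd := hasDerivAt_modeFun hγ hΓ hlam hκ.le hε (by linarith)
  have hP : ∀ q p, p ≤ 0 → partialP (firstMode L (modeFun γ lam κ ε)) q p
      = riccati γ lam κ ε p / aExt γ lam p ^ 3 * modeFun γ lam κ ε p * cos (π * q / L) :=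
    fun q p hp => ((hd p).mul_const (cos (π * q / L))).hasDerivWithinAt.derivWithin
      (uniqueDiffOn_Iic 0 p hp)
  refine ⟨memX_modeFun hL hα₀ hα₁ hγ hΓ hlam hκ.le hε (by linarith), fun q p _ _ hp => ?_,
    fun q _ _ => ?_⟩
  · have h1 : partialP (fun x s => aCoef γ lam s ^ 3
        * partialP (firstMode L (modeFun γ lam κ ε)) x s) q p
        = (qCoef γ lam κ ε p * modeFun γ lam κ ε p) * cos (π * q / L) := by
      have h2 : ∀ s ∈ Iic (0 : ℝ), aCoef γ lam s ^ 3
          * partialP (firstMode L (modeFun γ lam κ ε)) q s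
          = riccati γ lam κ ε s * modeFun γ lam κ ε s * cos (π * q / L) := fun s hs => by
        have := hpos s
        rw [hP q s hs, ← aExt_of_nonpos γ lam hs]
        field_simp
      rw [partialP, derivWithin_congr h2 (h2 p hp.le)]
      have h3 := (((isRiccati_riccati hγ hΓ hlam hκ.le hε (by linarith)).hasDerivAt p).mul
        (hd p)).mul_const (cos (π * q / L))
      refine (h3.hasDerivWithinAt.derivWithin (uniqueDiffOn_Iic 0 p hp.le)).trans ?_
      simp only [modeDeriv, modeDeriv₁]
      ring
    have h2 : partialQ (fun x s => aCoef γ lam s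
        * partialQ (firstMode L (modeFun γ lam κ ε)) x s) q p
        = aCoef γ lam p * (modeFun γ lam κ ε p * -(κ * cos (π * q / L))) := by
      rw [partialQ, deriv_const_mul_field]
      congr 1
      refine (mixedPartial_firstMode L (modeFun γ lam κ ε) 2 0 q p).trans ?_
      rw [iterate_deriv_cos]
      have h4 : π * q / L + ((2 : ℕ) : ℝ) * (π / 2) = π * q / L + π := by push_cast; ring
      simp only [h4, cos_add_pi, Function.iterate_zero, id]
      ring
    rw [h1, h2, ← aExt_of_nonpos γ lam hp.le]
    simp only [qCoef, firstMode]
    ring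
  · have := hpos 0
    rw [hP q 0 le_rfl, lam_rpow_eq hΓ hlam, hw0]
    simp only [firstMode]
    field_simp

end

/-! ### Cosine coefficients -/

/-- The `k`-th cosine coefficient of a function on `[-L, L]`, without normalization. -/
noncomputable def cosCoeff (L : ℝ) (k : ℕ) (f : ℝ → ℝ) : ℝ :=
  ∫ q in (-L)..L, f q * cos (k * (π * q / L))

lemma integral_eq_zero_of_odd {f : ℝ → ℝ} {L : ℝ} (hf : ∀ q, f (-q) = -f q) :
    ∫ q in (-L)..L, f q = 0 := by
  have h1 : ∫ q in (-L)..L, f (-q) = ∫ q in (-L)..L, f q := by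
    rw [intervalIntegral.integral_comp_neg, neg_neg]
  simp only [hf, intervalIntegral.integral_neg] at h1
  linarith

/-- A continuous even periodic function all of whose cosine coefficients vanish is zero. -/
lemma eq_zero_of_cosCoeff_eq_zero {f : ℝ → ℝ} {L : ℝ} (hL : 0 < L) (hc : Continuous f)
    (heven : ∀ q, f (-q) = f q) (hper : ∀ q, f (q + 2 * L) = f q)
    (hzero : ∀ k, cosCoeff L k f = 0) (q : ℝ) : f q = 0 := by
  have : Fact (0 < 2 * L) := ⟨by positivity⟩
  have hF : Function.Periodic (fun q => (f q : ℂ)) (2 * L) := fun q => by simp only [hper]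
  have hFc : Continuous hF.lift := by
    refine continuous_coinduced_dom.2 ?_
    change Continuous fun q => (f q : ℂ)
    fun_prop
  let F : C(AddCircle (2 * L), ℂ) := ⟨hF.lift, hFc⟩
  have hFq : ∀ q : ℝ, F (q : AddCircle (2 * L)) = (f q : ℂ) := fun q => rfl
  have hcoeff : fourierCoeff F = 0 := by
    funext n
    rw [fourierCoeff_eq_intervalIntegral _ n (-L)]
    have hend : -L + 2 * L = L := by ring
    rw [hend]
    have hint : ∀ x : ℝ, (fourier (-n) (x : AddCircle (2 * L)) : ℂ) • F (x : AddCircle (2 * L))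
        = ((f x * cos (n.natAbs * (π * x / L)) : ℝ) : ℂ)
          - Complex.I * ((f x * sin (n * (π * x / L)) : ℝ) : ℂ) := fun x => by
      have hcos : cos (n.natAbs * (π * x / L)) = cos (n * (π * x / L)) := by
        rcases Int.natAbs_eq n with h | h
        · conv_rhs => rw [h]
          simp
        · conv_rhs => rw [h]
          simp [neg_mul]
      have harg : 2 * (π : ℂ) * Complex.I * ((-n : ℤ) : ℂ) * (x : ℂ) / ((2 * L : ℝ) : ℂ)
          = ((-(n * (π * x / L)) : ℝ) : ℂ) * Complex.I := by
        have : (L : ℂ) ≠ 0 := by exact_mod_cast hL.ne'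
        push_cast
        field_simp
      rw [hFq, fourier_coe_apply, harg, Complex.exp_mul_I, ← Complex.ofReal_cos,
        ← Complex.ofReal_sin, cos_neg, sin_neg, hcos, smul_eq_mul]
      push_cast
      ring
    simp only [hint]
    have h1 : ∫ x in (-L)..L, ((f x * cos (n.natAbs * (π * x / L)) : ℝ) : ℂ) = 0 := by
      rw [intervalIntegral.integral_ofReal]
      exact_mod_cast hzero n.natAbs
    have h2 : ∫ x in (-L)..L, ((f x * sin (n * (π * x / L)) : ℝ) : ℂ) = 0 := by
      rw [intervalIntegral.integral_ofReal, integral_eq_zero_of_odd, Complex.ofReal_zero]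
      intro x
      have : (n : ℝ) * (π * -x / L) = -(n * (π * x / L)) := by ring
      rw [heven, this, sin_neg, mul_neg]
    rw [intervalIntegral.integral_sub, intervalIntegral.integral_const_mul, h1, h2]
    · simp
    · exact (by fun_prop : Continuous fun x : ℝ =>
        ((f x * cos (n.natAbs * (π * x / L)) : ℝ) : ℂ)).intervalIntegrable _ _
    · exact (by fun_prop : Continuous fun x : ℝ => Complex.I *
        ((f x * sin (n * (π * x / L)) : ℝ) : ℂ)).intervalIntegrable _ _
  have hsum := hasSum_fourier_series_of_summable (f := F) (by rw [hcoeff]; exact summable_zero)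
  simp only [hcoeff, Pi.zero_apply, zero_smul] at hsum
  have hF0 : F = 0 := hsum.unique hasSum_zero
  have := hFq q
  rw [hF0] at this
  exact Complex.ofReal_eq_zero.1 this.symm

/-- Integration by parts: the second derivative multiplies the cosine coefficient
by `-(kπ/L)²`. -/
lemma cosCoeff_deriv_deriv {f f' f'' : ℝ → ℝ} {L : ℝ} (hL : 0 < L) (k : ℕ)
    (hf : ∀ q, HasDerivAt f (f' q) q) (hf' : ∀ q, HasDerivAt f' (f'' q) q)
    (hc : Continuous f'') (hper : f' L = f' (-L)) :
    cosCoeff L k f'' = -(k * (π / L)) ^ 2 * cosCoeff L k f := by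
  have hlin : ∀ q, HasDerivAt (fun q : ℝ => k * (π * q / L)) (k * (π * 1 / L)) q := fun q =>
    (((hasDerivAt_id q).const_mul π).div_const L).const_mul _
  have hC : ∀ q, HasDerivAt (fun q : ℝ => cos (k * (π * q / L)))
      (-sin (k * (π * q / L)) * (k * (π * 1 / L))) q := fun q => (hlin q).cos
  have hS : ∀ q, HasDerivAt (fun q : ℝ => sin (k * (π * q / L)))
      (cos (k * (π * q / L)) * (k * (π * 1 / L))) q := fun q => (hlin q).sin
  have hf'c : Continuous f' := continuous_iff_continuousAt.2 fun q => (hf' q).continuousAt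
  have hend : (k : ℝ) * (π * L / L) = k * π := by field_simp
  have hend' : (k : ℝ) * (π * -L / L) = -(k * π) := by field_simp
  have h1 := intervalIntegral.integral_mul_deriv_eq_deriv_mul (a := -L) (b := L)
    (fun q _ => hC q) (fun q _ => hf' q)
    ((by fun_prop : Continuous fun q : ℝ =>
      -sin (k * (π * q / L)) * (k * (π * 1 / L))).intervalIntegrable _ _)
    (hc.intervalIntegrable _ _)
  have h2 := intervalIntegral.integral_mul_deriv_eq_deriv_mul (a := -L) (b := L)
    (fun q _ => hS q) (fun q _ => hf q)
    ((by fun_prop : Continuous fun q : ℝ =>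
      cos (k * (π * q / L)) * (k * (π * 1 / L))).intervalIntegrable _ _)
    (hf'c.intervalIntegrable _ _)
  rw [hend, hend', cos_neg, hper, sub_self, zero_sub] at h1
  rw [hend, hend', sin_neg, sin_nat_mul_pi] at h2
  simp only [neg_zero, zero_mul, sub_self, zero_sub] at h2
  have h3 : ∀ q, -sin (k * (π * q / L)) * (k * (π * 1 / L)) * f' q
      = -(k * (π / L)) * (sin (k * (π * q / L)) * f' q) := fun q => by ring
  have h4 : ∀ q, cos (k * (π * q / L)) * (k * (π * 1 / L)) * f q
      = (k * (π / L)) * (f q * cos (k * (π * q / L))) := fun q => by ring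
  have h5 : ∀ q, cos (k * (π * q / L)) * f'' q = f'' q * cos (k * (π * q / L)) :=
    fun q => mul_comm _ _
  simp only [h3, h4, h5, intervalIntegral.integral_const_mul] at h1 h2
  rw [cosCoeff, cosCoeff, h1, h2]
  ring

lemma cosCoeff_one_cos {L : ℝ} (hL : 0 < L) : cosCoeff L 1 (fun q => cos (π * q / L)) = L := by
  have h1 : ∀ q, cos (π * q / L) * cos ((1 : ℕ) * (π * q / L)) = cos (π / L * q) ^ 2 := fun q => by
    rw [Nat.cast_one, one_mul, sq, div_mul_eq_mul_div]
  have h2 : π / L ≠ 0 := by positivity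
  have h3 : π / L * L = π := by field_simp
  rw [cosCoeff]
  simp only [h1]
  rw [intervalIntegral.integral_comp_mul_left (fun x => cos x ^ 2) h2, integral_cos_sq, mul_neg,
    h3]
  simp

lemma cosCoeff_cos_of_ne_one {L : ℝ} (hL : 0 < L) {k : ℕ} (hk : k ≠ 1) :
    cosCoeff L k (fun q => cos (π * q / L)) = 0 := by
  have hlin : ∀ q, HasDerivAt (fun q : ℝ => π * q / L) (π * 1 / L) q := fun q =>
    ((hasDerivAt_id q).const_mul π).div_const L
  have h1 := cosCoeff_deriv_deriv hL k (fun q => (hlin q).cos)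
    (fun q => (hlin q).sin.neg.mul_const (π * 1 / L)) (by fun_prop)
    (by simp [hL.ne', neg_div])
  have h2 : cosCoeff L k (fun q => -(cos (π * q / L) * (π * 1 / L)) * (π * 1 / L))
      = -(π / L) ^ 2 * cosCoeff L k (fun q => cos (π * q / L)) := by
    simp only [cosCoeff]
    rw [← intervalIntegral.integral_const_mul]
    congr 1
    funext q
    ring
  rw [h2] at h1
  have h3 : (π / L) ^ 2 * (((k : ℝ) - 1) * (k + 1))
      * cosCoeff L k (fun q => cos (π * q / L)) = 0 := by linear_combination h1
  have h4 : (k : ℝ) - 1 ≠ 0 := sub_ne_zero.2 (by exact_mod_cast hk)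
  have h5 : (k : ℝ) + 1 ≠ 0 := by positivity
  have h6 : (π / L) ^ 2 ≠ 0 := by positivity
  simpa [h4, h5, h6, hL.ne', pi_ne_zero] using h3

/-! ### Partial derivatives on the half plane -/

/-- The closed lower half plane is a set of unique differentiability. -/
lemma uniqueDiffOn_halfPlane : UniqueDiffOn ℝ ((univ : Set ℝ) ×ˢ Iic (0 : ℝ)) :=
  uniqueDiffOn_univ.prod (uniqueDiffOn_Iic 0)

section partialDerivatives

variable {φ : ℝ → ℝ → ℝ} {n : ℕ}

lemma hasDerivWithinAt_partialP
    (h : DifferentiableOn ℝ (fun z : ℝ × ℝ => φ z.1 z.2) (univ ×ˢ Iic 0)) (q : ℝ) {p : ℝ}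
    (hp : p ≤ 0) : HasDerivWithinAt (fun s => φ q s)
      (fderivWithin ℝ (fun z : ℝ × ℝ => φ z.1 z.2) (univ ×ˢ Iic 0) (q, p) (0, 1)) (Iic 0) p := by
  have h1 := (h (q, p) ⟨trivial, hp⟩).hasFDerivWithinAt
  exact h1.comp_hasDerivWithinAt (f := fun s => (q, s)) p
    ((hasDerivWithinAt_const p (Iic 0) q).prodMk (hasDerivWithinAt_id p (Iic 0)))
    fun s hs => ⟨trivial, hs⟩

lemma hasDerivAt_partialQ
    (h : DifferentiableOn ℝ (fun z : ℝ × ℝ => φ z.1 z.2) (univ ×ˢ Iic 0)) (q : ℝ) {p : ℝ}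
    (hp : p ≤ 0) : HasDerivAt (fun x => φ x p)
      (fderivWithin ℝ (fun z : ℝ × ℝ => φ z.1 z.2) (univ ×ˢ Iic 0) (q, p) (1, 0)) q := by
  have h1 := (h (q, p) ⟨trivial, hp⟩).hasFDerivWithinAt
  rw [← hasDerivWithinAt_univ]
  exact h1.comp_hasDerivWithinAt (f := fun x => (x, p)) q
    ((hasDerivWithinAt_id q univ).prodMk (hasDerivWithinAt_const q univ p))
    fun s hs => ⟨trivial, hp⟩

lemma contDiffOn_partialP
    (h : ContDiffOn ℝ (n + 1) (fun z : ℝ × ℝ => φ z.1 z.2) (univ ×ˢ Iic 0)) :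
    ContDiffOn ℝ n (fun z : ℝ × ℝ => partialP φ z.1 z.2) (univ ×ˢ Iic 0) := by
  have h1 := h.fderivWithin (m := n) uniqueDiffOn_halfPlane le_rfl
  refine (h1.clm_apply (contDiffOn_const (c := ((0 : ℝ), (1 : ℝ))))).congr fun z hz => ?_
  exact (hasDerivWithinAt_partialP (h.differentiableOn (by simp)) z.1 hz.2).derivWithin
    (uniqueDiffOn_Iic 0 _ hz.2)

lemma contDiffOn_partialQ
    (h : ContDiffOn ℝ (n + 1) (fun z : ℝ × ℝ => φ z.1 z.2) (univ ×ˢ Iic 0)) :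
    ContDiffOn ℝ n (fun z : ℝ × ℝ => partialQ φ z.1 z.2) (univ ×ˢ Iic 0) := by
  have h1 := h.fderivWithin (m := n) uniqueDiffOn_halfPlane le_rfl
  refine (h1.clm_apply (contDiffOn_const (c := ((1 : ℝ), (0 : ℝ))))).congr fun z hz => ?_
  exact (hasDerivAt_partialQ (h.differentiableOn (by simp)) z.1 hz.2).deriv

lemma hasDerivAt_partialP_of_neg
    (h : DifferentiableOn ℝ (fun z : ℝ × ℝ => φ z.1 z.2) (univ ×ˢ Iic 0)) (q : ℝ) {p : ℝ}
    (hp : p < 0) : HasDerivAt (fun s => φ q s) (partialP φ q p) p := by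
  have h1 := hasDerivWithinAt_partialP h q hp.le
  rw [partialP, h1.derivWithin (uniqueDiffOn_Iic 0 p hp.le)]
  exact h1.hasDerivAt (Iic_mem_nhds hp)

lemma continuous_section
    (h : ContinuousOn (fun z : ℝ × ℝ => φ z.1 z.2) (univ ×ˢ Iic 0)) {p : ℝ} (hp : p ≤ 0) :
    Continuous fun q => φ q p :=
  h.comp_continuous (f := fun q => (q, p)) (by fun_prop) fun _ => ⟨trivial, hp⟩

lemma continuousOn_cosCoeff {L : ℝ} (k : ℕ)
    (h : ContinuousOn (fun z : ℝ × ℝ => φ z.1 z.2) (univ ×ˢ Iic 0)) :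
    ContinuousOn (fun p => cosCoeff L k fun q => φ q p) (Iic 0) := by
  have h1 : Continuous fun z : ℝ × ℝ => φ z.2 (min z.1 0) :=
    h.comp_continuous (f := fun z : ℝ × ℝ => (z.2, min z.1 0)) (by fun_prop)
      fun _ => ⟨trivial, mem_Iic.2 (min_le_right _ _)⟩
  have h2 : Continuous fun p => cosCoeff L k fun q => φ q (min p 0) :=
    intervalIntegral.continuous_parametric_intervalIntegral_of_continuous'
      (f := fun p q => φ q (min p 0) * cos (k * (π * q / L)))
      (h1.mul (by fun_prop : Continuous fun z : ℝ × ℝ => cos (k * (π * z.2 / L)))) _ _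
  refine h2.continuousOn.congr fun p hp => ?_
  simp only [min_eq_left (show p ≤ 0 from hp)]

lemma abs_cosCoeff_le {L C : ℝ} (hL : 0 < L) (k : ℕ) {f : ℝ → ℝ} (hf : ∀ q, |f q| ≤ C) :
    |cosCoeff L k f| ≤ C * (2 * L) := by
  have h1 := intervalIntegral.norm_integral_le_of_norm_le_const (a := -L) (b := L) (C := C)
    (f := fun q => f q * cos (k * (π * q / L))) fun q _ => by
      rw [norm_mul]
      exact (mul_le_of_le_one_right (norm_nonneg _) (abs_cos_le_one _)).trans (hf q)
  rwa [sub_neg_eq_add, ← two_mul, abs_of_pos (by positivity)] at h1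

lemma hasDerivAt_cosCoeff {L : ℝ} (k : ℕ)
    (h : ContDiffOn ℝ 1 (fun z : ℝ × ℝ => φ z.1 z.2) (univ ×ˢ Iic 0))
    (hb : ∃ C, ∀ q p, p ≤ 0 → |partialP φ q p| ≤ C) {p : ℝ} (hp : p < 0) :
    HasDerivAt (fun p => cosCoeff L k fun q => φ q p) (cosCoeff L k fun q => partialP φ q p) p := by
  obtain ⟨C, hC⟩ := hb
  have hP : ContinuousOn (fun z : ℝ × ℝ => partialP φ z.1 z.2) (univ ×ˢ Iic 0) :=
    (contDiffOn_partialP (n := 0) (by simpa using h)).continuousOn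
  have hcs : ∀ s ≤ 0, Continuous fun q => φ q s * cos (k * (π * q / L)) := fun s hs => by
    have := continuous_section h.continuousOn hs
    fun_prop
  have hcs' : Continuous fun q => partialP φ q p * cos (k * (π * q / L)) := by
    have := continuous_section hP hp.le
    fun_prop
  refine (intervalIntegral.hasDerivAt_integral_of_dominated_loc_of_deriv_le (bound := fun _ => C)
    (F := fun s q => φ q s * cos (k * (π * q / L)))
    (F' := fun s q => partialP φ q s * cos (k * (π * q / L))) (Iio_mem_nhds hp) ?_
    ((hcs p hp.le).intervalIntegrable _ _) hcs'.aestronglyMeasurable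
    (ae_of_all _ fun q _ s hs => ?_) (by simp) (ae_of_all _ fun q _ s hs => ?_)).2
  · filter_upwards [Iio_mem_nhds hp] with s hs
    exact (hcs s (le_of_lt hs)).aestronglyMeasurable
  · rw [norm_mul]
    exact (mul_le_of_le_one_right (norm_nonneg _) (abs_cos_le_one _)).trans (hC q s (le_of_lt hs))
  · exact (hasDerivAt_partialP_of_neg (h.differentiableOn one_ne_zero) q hs).mul_const _

end partialDerivatives

/-! ### The modes of a solution -/

/-- A function that is constant on `(-∞, 0)` and continuous up to `0` equals its value at `0`. -/
lemma eq_of_hasDerivAt_zero {f : ℝ → ℝ} (hc : ContinuousOn f (Iic 0))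
    (hd : ∀ p < 0, HasDerivAt f 0 p) {p : ℝ} (hp : p ≤ 0) : f p = f 0 :=
  (constant_of_has_deriv_right_zero (hc.mono Icc_subset_Iic_self)
    (fun x hx => (hd x hx.2).hasDerivWithinAt) 0 ⟨hp, le_rfl⟩).symm

section modes

variable {g L α ε lam : ℝ} {γ : ℝ → ℝ} {φ : ℝ → ℝ → ℝ}

lemma IsEigenSolution.contDiffOn (h : IsEigenSolution g L α γ ε lam φ) :
    ContDiffOn ℝ 3 (fun z : ℝ × ℝ => φ z.1 z.2) (univ ×ˢ Iic 0) :=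
  h.memX.holderPer.contDiffOn

lemma IsEigenSolution.contDiffOn_partialP (h : IsEigenSolution g L α γ ε lam φ) :
    ContDiffOn ℝ 2 (fun z : ℝ × ℝ => partialP φ z.1 z.2) (univ ×ˢ Iic 0) :=
  StokesWave.contDiffOn_partialP (n := 2) (h.contDiffOn.of_le (by norm_num))

/-- The first two `p`-derivatives of the cosine coefficients of a solution. -/
lemma IsEigenSolution.hasDerivAt_cosCoeff (h : IsEigenSolution g L α γ ε lam φ) (k : ℕ) {p : ℝ}
    (hp : p < 0) :
    HasDerivAt (fun p => cosCoeff L k fun q => φ q p) (cosCoeff L k fun q => partialP φ q p) p ∧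
    HasDerivAt (fun p => cosCoeff L k fun q => partialP φ q p)
      (cosCoeff L k fun q => partialP (partialP φ) q p) p :=
  ⟨StokesWave.hasDerivAt_cosCoeff k (h.contDiffOn.of_le (by norm_num))
      (h.memX.holderPer.bounded 0 1 (by norm_num)) hp,
    StokesWave.hasDerivAt_cosCoeff k (h.contDiffOn_partialP.of_le (by norm_num))
      (h.memX.holderPer.bounded 0 2 (by norm_num)) hp⟩

/-- The ordinary differential equation satisfied by the cosine coefficients of a solution. -/
lemma IsEigenSolution.cosCoeff_equation (hL : 0 < L) (hγ : HolderC1 α γ) (hΓ : GamBounded γ)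
    (hlam : -2 * GamInf γ < lam) (h : IsEigenSolution g L α γ ε lam φ) (k : ℕ) {p : ℝ}
    (hp : p < 0) :
    3 * aExt γ lam p * γ (-p) * (cosCoeff L k fun q => partialP φ q p)
      + aExt γ lam p ^ 3 * (cosCoeff L k fun q => partialP (partialP φ) q p)
      = qCoef γ lam ((k * (π / L)) ^ 2) ε p * cosCoeff L k fun q => φ q p := by
  have hPP : ContinuousOn (fun z : ℝ × ℝ => partialP (partialP φ) z.1 z.2) (univ ×ˢ Iic 0) :=
    (StokesWave.contDiffOn_partialP (n := 1)
      (h.contDiffOn_partialP.of_le (by norm_num))).continuousOn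
  have hQ : ContDiffOn ℝ 2 (fun z : ℝ × ℝ => partialQ φ z.1 z.2) (univ ×ˢ Iic 0) :=
    contDiffOn_partialQ (n := 2) (h.contDiffOn.of_le (by norm_num))
  have hQQ : ContinuousOn (fun z : ℝ × ℝ => partialQ (partialQ φ) z.1 z.2) (univ ×ˢ Iic 0) :=
    (contDiffOn_partialQ (n := 1) (hQ.of_le (by norm_num))).continuousOn
  have c0 := continuous_section h.contDiffOn.continuousOn hp.le
  have c1 := continuous_section h.contDiffOn_partialP.continuousOn hp.le
  have c2 := continuous_section hPP hp.le
  have c3 := continuous_section hQQ hp.le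
  have hparts : (cosCoeff L k fun q => partialQ (partialQ φ) q p)
      = -(k * (π / L)) ^ 2 * cosCoeff L k fun q => φ q p := by
    refine cosCoeff_deriv_deriv hL k
      (fun q => (hasDerivAt_partialQ (h.contDiffOn.differentiableOn (by norm_num)) q
        hp.le).differentiableAt.hasDerivAt)
      (fun q => (hasDerivAt_partialQ (hQ.differentiableOn (by norm_num)) q
        hp.le).differentiableAt.hasDerivAt) c3 ?_
    have hper : (fun x => φ (x + 2 * L) p) = fun x => φ x p :=
      funext fun x => h.memX.holderPer.periodic x p hp.le
    have h1 := deriv_comp_add_const (fun x => φ x p) (2 * L) (-L)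
    rw [hper] at h1
    rw [h1]
    congr 1
    ring
  have hpt : ∀ q, -L < q → q < L →
      3 * aExt γ lam p * γ (-p) * partialP φ q p + aExt γ lam p ^ 3 * partialP (partialP φ) q p
        + aExt γ lam p * partialQ (partialQ φ) q p - ε * aExt γ lam p ^ 3 * φ q p = 0 := by
    intro q h1 h2
    rw [← h.interior q p h1 h2 hp, aExt_of_nonpos γ lam hp.le]
    have h3 : partialQ (fun x s => aCoef γ lam s * partialQ φ x s) q p
        = aCoef γ lam p * partialQ (partialQ φ) q p := by
      rw [partialQ, deriv_const_mul_field]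
      rfl
    have h4 : partialP (fun x s => aCoef γ lam s ^ 3 * partialP φ x s) q p
        = 3 * aCoef γ lam p * γ (-p) * partialP φ q p
          + aCoef γ lam p ^ 3 * partialP (partialP φ) q p := by
      have h5 : HasDerivWithinAt (fun s => aCoef γ lam s ^ 3) (3 * aCoef γ lam p * γ (-p))
          (Iic 0) p := by
        have h6 := hasDerivWithinAt_cube_aExt hγ hΓ hlam hp.le
        rw [aExt_of_nonpos γ lam hp.le] at h6
        exact h6.congr (fun s hs => by rw [aExt_of_nonpos γ lam hs])
          (by rw [aExt_of_nonpos γ lam hp.le])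
      exact (h5.mul (hasDerivAt_partialP_of_neg
        (h.contDiffOn_partialP.differentiableOn (by norm_num)) q hp).hasDerivWithinAt).derivWithin
        (uniqueDiffOn_Iic 0 p hp.le)
    rw [h3, h4]
  have hzero : cosCoeff L k (fun q => 3 * aExt γ lam p * γ (-p) * partialP φ q p
      + aExt γ lam p ^ 3 * partialP (partialP φ) q p
      + aExt γ lam p * partialQ (partialQ φ) q p - ε * aExt γ lam p ^ 3 * φ q p) = 0 := by
    refine intervalIntegral.integral_zero_ae ?_
    filter_upwards [Measure.ae_ne volume L] with q hq hmem
    rw [uIoc_of_le (by linarith)] at hmem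
    rw [hpt q hmem.1 (lt_of_le_of_ne hmem.2 hq), zero_mul]
  have hlinear : cosCoeff L k (fun q => 3 * aExt γ lam p * γ (-p) * partialP φ q p
      + aExt γ lam p ^ 3 * partialP (partialP φ) q p
      + aExt γ lam p * partialQ (partialQ φ) q p - ε * aExt γ lam p ^ 3 * φ q p)
      = 3 * aExt γ lam p * γ (-p) * (cosCoeff L k fun q => partialP φ q p)
        + aExt γ lam p ^ 3 * (cosCoeff L k fun q => partialP (partialP φ) q p)
        + aExt γ lam p * (cosCoeff L k fun q => partialQ (partialQ φ) q p)
        - ε * aExt γ lam p ^ 3 * cosCoeff L k fun q => φ q p := by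
    have hI : ∀ {f : ℝ → ℝ}, Continuous f →
        IntervalIntegrable (fun q => f q * cos (k * (π * q / L))) volume (-L) L := fun {f} hf =>
      (by fun_prop : Continuous fun q => f q * cos (k * (π * q / L))).intervalIntegrable _ _
    simp only [cosCoeff, ← intervalIntegral.integral_const_mul]
    rw [← intervalIntegral.integral_add ((hI c1).const_mul _) ((hI c2).const_mul _),
      ← intervalIntegral.integral_add (((hI c1).const_mul _).add ((hI c2).const_mul _))
        ((hI c3).const_mul _),
      ← intervalIntegral.integral_sub ((((hI c1).const_mul _).add ((hI c2).const_mul _)).add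
        ((hI c3).const_mul _)) ((hI c0).const_mul _)]
    congr 1
    funext q
    ring
  rw [hlinear, hparts] at hzero
  simp only [qCoef]
  linear_combination hzero

lemma IsEigenSolution.cosCoeff_boundary (hL : 0 < L) (hΓ : GamBounded γ)
    (hlam : -2 * GamInf γ < lam) (h : IsEigenSolution g L α γ ε lam φ) (k : ℕ) :
    aExt γ lam 0 ^ 3 * (cosCoeff L k fun q => partialP φ q 0)
      = g * cosCoeff L k fun q => φ q 0 := by
  rw [cosCoeff, cosCoeff, ← intervalIntegral.integral_const_mul,
    ← intervalIntegral.integral_const_mul, ← lam_rpow_eq hΓ hlam]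
  refine intervalIntegral.integral_congr_ae ?_
  filter_upwards [Measure.ae_ne volume L] with q hq hmem
  rw [uIoc_of_le (by linarith)] at hmem
  rw [← mul_assoc, ← mul_assoc, h.boundary q hmem.1 (lt_of_le_of_ne hmem.2 hq)]

/-- The cosine coefficients of a solution are multiples of the decaying solution of their
equation: with the Riccati solution `w`, the function `a³ v' - w v` satisfies
`z' = -(w / a³) z` and is bounded, so it vanishes. The boundary condition leaves
`(w(0) - g) v(0) = 0`. -/
lemma IsEigenSolution.cosCoeff_eq (hL : 0 < L) (hγ : HolderC1 α γ) (hΓ : GamBounded γ)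
    (hlam : -2 * GamInf γ < lam) (hε : 0 ≤ ε) (h : IsEigenSolution g L α γ ε lam φ) (k : ℕ)
    (hk : 0 < (k * (π / L)) ^ 2 + ε) :
    (∀ p ≤ 0, (cosCoeff L k fun q => φ q p)
      = (cosCoeff L k fun q => φ q 0) * modeFun γ lam ((k * (π / L)) ^ 2) ε p) ∧
    (riccati γ lam ((k * (π / L)) ^ 2) ε 0 - g) * (cosCoeff L k fun q => φ q 0) = 0 := by
  set κ := (k * (π / L)) ^ 2 with hκdef
  have hκ : 0 ≤ κ := sq_nonneg _
  have ha := uniformlyPositive_aExt hγ hΓ hlam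
  have hR := isRiccati_riccati hγ hΓ hlam hκ hε hk
  set w := riccati γ lam κ ε with hw
  have hwp := hR.uniformlyPositive
  set c₀ : ℝ → ℝ := fun p => cosCoeff L k fun q => φ q p with hc₀
  set c₁ : ℝ → ℝ := fun p => cosCoeff L k fun q => partialP φ q p with hc₁
  have hc₀c : ContinuousOn c₀ (Iic 0) := continuousOn_cosCoeff k h.contDiffOn.continuousOn
  have hc₁c : ContinuousOn c₁ (Iic 0) := continuousOn_cosCoeff k h.contDiffOn_partialP.continuousOn
  have hzc : ContinuousOn (fun p => aExt γ lam p ^ 3 * c₁ p - w p * c₀ p) (Iic 0) :=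
    ((ha.pow 3).continuous.continuousOn.mul hc₁c).sub (hwp.continuous.continuousOn.mul hc₀c)
  have hzd : ∀ p < 0, HasDerivAt (fun p => aExt γ lam p ^ 3 * c₁ p - w p * c₀ p)
      (-(w p / aExt γ lam p ^ 3 * (aExt γ lam p ^ 3 * c₁ p - w p * c₀ p))) p := fun p hp => by
    obtain ⟨h1, h2⟩ := h.hasDerivAt_cosCoeff k hp
    have h3 := (hasDerivWithinAt_cube_aExt hγ hΓ hlam hp.le).hasDerivAt (Iic_mem_nhds hp)
    refine ((h3.mul h2).sub ((hR.hasDerivAt p).mul h1)).congr_deriv ?_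
    have h4 := h.cosCoeff_equation hL hγ hΓ hlam k hp
    have h5 := ha.pos p
    rw [h4, ← hκdef]
    simp only [hc₀, hc₁]
    field_simp
    ring
  obtain ⟨C₀, hC₀⟩ := h.memX.holderPer.bounded 0 0 (by norm_num)
  obtain ⟨C₁, hC₁⟩ := h.memX.holderPer.bounded 0 1 (by norm_num)
  obtain ⟨_, A, _, hA⟩ := (ha.pow 3).bounds
  obtain ⟨_, W, _, hW⟩ := hwp.bounds
  have hzb : ∀ p ≤ 0, |aExt γ lam p ^ 3 * c₁ p - w p * c₀ p|
      ≤ A * (C₁ * (2 * L)) + W * (C₀ * (2 * L)) := fun p hp => by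
    refine (abs_sub _ _).trans (add_le_add ?_ ?_)
    · rw [abs_mul, abs_of_pos ((ha.pow 3).pos p)]
      exact mul_le_mul (hA p).2 (abs_cosCoeff_le hL k fun q => hC₁ q p hp) (abs_nonneg _)
        (((ha.pow 3).pos p).le.trans (hA p).2)
    · rw [abs_mul, abs_of_pos (hwp.pos p)]
      exact mul_le_mul (hW p).2 (abs_cosCoeff_le hL k fun q => hC₀ q p hp) (abs_nonneg _)
        ((hwp.pos p).le.trans (hW p).2)
  have hh := hwp.div (ha.pow 3)
  obtain ⟨h₀, _, h₀pos, hb⟩ := hh.bounds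
  have hz : ∀ p ≤ 0, aExt γ lam p ^ 3 * c₁ p = w p * c₀ p := fun p hp => by
    have h1 := nonpos_of_deriv_le hzc hzd hh.continuous h₀pos (fun p => (hb p).1)
      (fun p _ => le_rfl) (fun p hp => (le_abs_self _).trans (hzb p hp)) p hp
    have h2 := nonpos_of_deriv_le hzc.neg (fun p hp => (hzd p hp).neg) hh.continuous h₀pos
      (fun p => (hb p).1) (fun p _ => by simp only [Pi.neg_apply, mul_neg, le_refl])
      (fun p hp => (neg_le_abs _).trans (hzb p hp)) p hp
    simp only [Pi.neg_apply] at h2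
    linarith
  constructor
  · have hvpos := modeFun_pos γ lam κ ε
    have hv := hasDerivAt_modeFun hγ hΓ hlam hκ hε hk
    have hvc : Continuous (modeFun γ lam κ ε) :=
      continuous_iff_continuousAt.2 fun p => (hv p).continuousAt
    intro p hp
    have h1 := eq_of_hasDerivAt_zero (f := fun p => c₀ p / modeFun γ lam κ ε p)
      (hc₀c.div hvc.continuousOn fun p _ => (hvpos p).ne') (fun p hp => by
        refine ((h.hasDerivAt_cosCoeff k hp).1.div (hv p) (hvpos p).ne').congr_deriv ?_
        have h2 := hz p hp.le
        have h3 := ha.pos p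
        have h4 : (cosCoeff L k fun q => partialP φ q p) = w p * c₀ p / aExt γ lam p ^ 3 := by
          rw [eq_div_iff (by positivity), mul_comm]
          exact h2
        rw [h4, modeDeriv, modeDeriv₁, div_eq_zero_iff]
        left
        simp only [hc₀, hw]
        ring) hp
    have h2 : modeFun γ lam κ ε 0 = 1 := by simp [modeFun]
    simp only [h2, div_one] at h1
    rwa [div_eq_iff (hvpos p).ne'] at h1
  · have h1 := hz 0 le_rfl
    have h2 := h.cosCoeff_boundary hL hΓ hlam k
    simp only [hc₀, hc₁] at h1
    linear_combination h2 - h1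

/-- For `ε = 0` the mean of a solution vanishes: `a³ v'` is constant and decays. -/
lemma IsEigenSolution.cosCoeff_zero_eq_zero (hL : 0 < L) (hγ : HolderC1 α γ) (hΓ : GamBounded γ)
    (hlam : -2 * GamInf γ < lam) (h : IsEigenSolution g L α γ 0 lam φ) {p : ℝ} (hp : p ≤ 0) :
    (cosCoeff L 0 fun q => φ q p) = 0 := by
  have ha := uniformlyPositive_aExt hγ hΓ hlam
  have hdecay : ∀ ψ : ℝ → ℝ → ℝ, TendstoUniformly (fun p q => ψ q p) (fun _ => 0) atBot →
      Tendsto (fun p => cosCoeff L 0 fun q => ψ q p) atBot (𝓝 0) := by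
    intro ψ hψ
    rw [Metric.tendsto_nhds]
    intro e he
    filter_upwards [Metric.tendstoUniformly_iff.1 hψ (e / (2 * (2 * L))) (by positivity)] with p hp
    rw [dist_zero_right]
    refine (abs_cosCoeff_le hL 0 (C := e / (2 * (2 * L))) fun q => ?_).trans_lt ?_
    · have := (hp q).le
      rwa [dist_comm, dist_zero_right] at this
    · field_simp
      norm_num
  have hc₀c : ContinuousOn (fun p => cosCoeff L 0 fun q => φ q p) (Iic 0) :=
    continuousOn_cosCoeff 0 h.contDiffOn.continuousOn
  have hc₁c : ContinuousOn (fun p => cosCoeff L 0 fun q => partialP φ q p) (Iic 0) :=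
    continuousOn_cosCoeff 0 h.contDiffOn_partialP.continuousOn
  have h1 : ∀ p ≤ 0, aExt γ lam p ^ 3 * (cosCoeff L 0 fun q => partialP φ q p)
      = aExt γ lam 0 ^ 3 * cosCoeff L 0 fun q => partialP φ q 0 := fun p hp =>
    eq_of_hasDerivAt_zero
      (f := fun p => aExt γ lam p ^ 3 * (cosCoeff L 0 fun q => partialP φ q p))
      ((ha.pow 3).continuous.continuousOn.mul hc₁c) (fun p hp => by
        have h3 := (hasDerivWithinAt_cube_aExt hγ hΓ hlam hp.le).hasDerivAt (Iic_mem_nhds hp)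
        refine (h3.mul (h.hasDerivAt_cosCoeff 0 hp).2).congr_deriv ?_
        rw [h.cosCoeff_equation hL hγ hΓ hlam 0 hp]
        simp [qCoef]) hp
  obtain ⟨_, A, _, hA⟩ := (ha.pow 3).bounds
  have h2 : aExt γ lam 0 ^ 3 * (cosCoeff L 0 fun q => partialP φ q 0) = 0 := by
    have h3 : Tendsto (fun p => aExt γ lam p ^ 3 * (cosCoeff L 0 fun q => partialP φ q p)) atBot
        (𝓝 0) := by
      refine squeeze_zero_norm (fun p => ?_)
        (by simpa using (hdecay _ (h.memX.decay 0 1 (by norm_num))).abs.const_mul A)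
      rw [norm_mul, Real.norm_eq_abs, Real.norm_eq_abs, abs_of_pos ((ha.pow 3).pos p)]
      exact mul_le_mul_of_nonneg_right (hA p).2 (abs_nonneg _)
    refine tendsto_nhds_unique (tendsto_const_nhds.congr' ?_) h3
    filter_upwards [eventually_le_atBot 0] with p hp using (h1 p hp).symm
  have h4 : ∀ p ≤ 0, (cosCoeff L 0 fun q => partialP φ q p) = 0 := fun p hp => by
    have := h1 p hp
    rw [h2] at this
    exact (mul_eq_zero.1 this).resolve_left ((ha.pow 3).pos p).ne'
  have h5 : ∀ p ≤ 0, (cosCoeff L 0 fun q => φ q p) = cosCoeff L 0 fun q => φ q 0 := fun p hp =>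
    eq_of_hasDerivAt_zero hc₀c (fun p hp => by
      have := (h.hasDerivAt_cosCoeff 0 hp).1
      rwa [h4 p hp.le] at this) hp
  rw [h5 p hp]
  refine tendsto_nhds_unique (tendsto_const_nhds.congr' ?_)
    (hdecay _ (h.memX.decay 0 0 (by norm_num)))
  filter_upwards [eventually_le_atBot 0] with p hp using (h5 p hp).symm

/-- If the first mode satisfies the boundary condition, then no other mode does, because `w(0)`
is strictly increasing in the wave number. -/
lemma IsEigenSolution.cosCoeff_eq_zero (hL : 0 < L) (hγ : HolderC1 α γ) (hΓ : GamBounded γ)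
    (hlam : -2 * GamInf γ < lam) (hε : 0 ≤ ε) (hw0 : riccati γ lam ((π / L) ^ 2) ε 0 = g)
    (h : IsEigenSolution g L α γ ε lam φ) {k : ℕ} (hk : k ≠ 1) {p : ℝ} (hp : p ≤ 0) :
    (cosCoeff L k fun q => φ q p) = 0 := by
  have hκ : 0 < (π / L) ^ 2 := by positivity
  have key : 0 < (k * (π / L)) ^ 2 + ε → riccati γ lam ((k * (π / L)) ^ 2) ε 0 ≠ g →
      (cosCoeff L k fun q => φ q p) = 0 := fun h1 h2 => by
    obtain ⟨h3, h4⟩ := h.cosCoeff_eq hL hγ hΓ hlam hε k h1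
    rw [h3 p hp, (mul_eq_zero.1 h4).resolve_left (sub_ne_zero.2 h2), zero_mul]
  rcases Nat.eq_zero_or_pos k with rfl | hkpos
  · rcases hε.eq_or_lt with rfl | hεpos
    · exact h.cosCoeff_zero_eq_zero hL hγ hΓ hlam hp
    · have h0 : ((0 : ℕ) * (π / L)) ^ 2 = 0 := by simp
      refine key (by rw [h0]; linarith) ?_
      rw [h0, ← hw0]
      exact (riccati_zero_strictMono_mode hγ hΓ hlam le_rfl hκ hε (by linarith)).ne
  · have h2 : (2 : ℝ) ≤ k := by exact_mod_cast (by omega : 2 ≤ k)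
    have hlt : (π / L) ^ 2 < (k * (π / L)) ^ 2 := by
      have h3 : (4 : ℝ) ≤ (k : ℝ) ^ 2 := by nlinarith
      rw [mul_pow]
      nlinarith
    refine key (by linarith) ?_
    rw [← hw0]
    exact (riccati_zero_strictMono_mode hγ hΓ hlam hκ.le hlt hε (by linarith)).ne'

/-- The solution space is at most one-dimensional. -/
lemma IsEigenSolution.eq_firstMode (hL : 0 < L) (hγ : HolderC1 α γ) (hΓ : GamBounded γ)
    (hlam : -2 * GamInf γ < lam) (hε : 0 ≤ ε) (hw0 : riccati γ lam ((π / L) ^ 2) ε 0 = g)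
    (h : IsEigenSolution g L α γ ε lam φ) :
    ∃ c : ℝ, ∀ q p, p ≤ 0 → φ q p = c * firstMode L (modeFun γ lam ((π / L) ^ 2) ε) q p := by
  have hκ : 0 < (π / L) ^ 2 := by positivity
  have h1 := (h.cosCoeff_eq hL hγ hΓ hlam hε 1 (by rw [Nat.cast_one, one_mul]; linarith)).1
  rw [Nat.cast_one, one_mul] at h1
  refine ⟨(cosCoeff L 1 fun q => φ q 0) / L, fun q p hp => ?_⟩
  set b := (cosCoeff L 1 fun q => φ q 0) / L * modeFun γ lam ((π / L) ^ 2) ε p with hb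
  have hc := continuous_section h.contDiffOn.continuousOn hp
  have hcoeff : ∀ k, cosCoeff L k (fun q => φ q p - b * cos (π * q / L))
      = (cosCoeff L k fun q => φ q p) - b * cosCoeff L k fun q => cos (π * q / L) := fun k => by
    simp only [cosCoeff]
    rw [← intervalIntegral.integral_const_mul, ← intervalIntegral.integral_sub]
    · congr 1
      funext q
      ring
    · exact (by fun_prop : Continuous fun q =>
        φ q p * cos (k * (π * q / L))).intervalIntegrable _ _
    · exact (by fun_prop : Continuous fun q : ℝ =>
        b * (cos (π * q / L) * cos (k * (π * q / L)))).intervalIntegrable _ _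
  have h2 := eq_zero_of_cosCoeff_eq_zero (f := fun q => φ q p - b * cos (π * q / L)) hL
    (by fun_prop)
    (fun q => by
      have : π * -q / L = -(π * q / L) := by ring
      rw [h.memX.holderPer.even q p hp, this, cos_neg])
    (fun q => by
      have : π * (q + 2 * L) / L = π * q / L + 2 * π := by field_simp
      rw [h.memX.holderPer.periodic q p hp, this, cos_add_two_pi])
    (fun k => by
      rw [hcoeff]
      rcases eq_or_ne k 1 with rfl | hk
      · rw [h1 p hp, cosCoeff_one_cos hL, hb]
        field_simp
        ring
      · rw [h.cosCoeff_eq_zero hL hγ hΓ hlam hε hw0 hk hp, cosCoeff_cos_of_ne_one hL hk]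
        ring) q
  simp only [hb, sub_eq_zero] at h2
  rw [h2, firstMode]
  ring

/-- A nontrivial solution of the form `v(p) cos(πq/L)` forces `w(0) = g`. -/
lemma riccati_zero_eq_of_isEigenSolution {v : ℝ → ℝ} (hL : 0 < L) (hγ : HolderC1 α γ)
    (hΓ : GamBounded γ) (hlam : -2 * GamInf γ < lam) (hε : 0 ≤ ε)
    (hv : Nontrivial (firstMode L v)) (h : IsEigenSolution g L α γ ε lam (firstMode L v)) :
    riccati γ lam ((π / L) ^ 2) ε 0 = g := by
  have hκ : 0 < (π / L) ^ 2 := by positivity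
  obtain ⟨h1, h2⟩ := h.cosCoeff_eq hL hγ hΓ hlam hε 1 (by rw [Nat.cast_one, one_mul]; linarith)
  rw [Nat.cast_one, one_mul] at h1 h2
  by_contra hne
  have h3 := (mul_eq_zero.1 h2).resolve_left (sub_ne_zero.2 hne)
  obtain ⟨q, p, hp, hqp⟩ := hv
  have h4 : (cosCoeff L 1 fun q => firstMode L v q p) = v p * L := by
    have h5 : (cosCoeff L 1 fun q => firstMode L v q p)
        = v p * cosCoeff L 1 fun q => cos (π * q / L) := by
      rw [cosCoeff, cosCoeff, ← intervalIntegral.integral_const_mul]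
      congr 1
      funext q
      rw [firstMode, mul_assoc]
    rw [h5, cosCoeff_one_cos hL]
  have h5 := h1 p hp
  rw [h3, zero_mul, h4] at h5
  have h6 : v p = 0 := (mul_eq_zero.1 h5).resolve_right hL.ne'
  exact hqp (by simp [firstMode, h6])

end modes

end StokesWave

theorem mainTheorem7 (g L α : ℝ) (γ : ℝ → ℝ)
    (hg : 0 < g) (hL : 0 < L) (hα₀ : 0 < α) (hα₁ : α < 1)
    (hγ : StokesWave.HolderC1 α γ)
    (hΓ : StokesWave.GamBounded γ)
    (hbif : StokesWave.BifurcationCondition g L γ) :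
    ∃ lam : ℝ → ℝ,
      (∀ ε ∈ Set.Ico (0 : ℝ) 1,
        lam ε ∈ Set.Ioc (-2 * StokesWave.GamInf γ) (g * L / Real.pi - 2 * StokesWave.GamInf γ) ∧
        (∀ μ ∈ Set.Ioc (-2 * StokesWave.GamInf γ) (g * L / Real.pi - 2 * StokesWave.GamInf γ),
          (∃ v : ℝ → ℝ, StokesWave.Nontrivial (StokesWave.firstMode L v) ∧
            StokesWave.IsEigenSolution g L α γ ε μ (StokesWave.firstMode L v)) ↔ μ = lam ε) ∧
        ∃ Φ : ℝ → ℝ,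
          (∀ p, p ≤ 0 → 0 < Φ p) ∧
          (∃ K σ : ℝ, 0 < σ ∧ ∀ p, p ≤ 0 → |Φ p| ≤ K * Real.exp (σ * p)) ∧
          StokesWave.IsEigenSolution g L α γ ε (lam ε) (StokesWave.firstMode L Φ) ∧
          ∀ φ : ℝ → ℝ → ℝ, StokesWave.IsEigenSolution g L α γ ε (lam ε) φ →
            ∃ c : ℝ, ∀ q p, p ≤ 0 → φ q p = c * StokesWave.firstMode L Φ q p) ∧
      (∀ ε ∈ Set.Ico (0 : ℝ) 1, lam ε ≤ lam 0) ∧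
      Filter.Tendsto lam (nhdsWithin 0 (Set.Ioi 0)) (nhds (lam 0)) := by
  have hκ : 0 < (π / L) ^ 2 := by positivity
  have hex : ∀ ε : ℝ, ∃ lam, ε ∈ Ico (0 : ℝ) 1 →
      lam ∈ Ioc (-2 * StokesWave.GamInf γ) (g * L / π - 2 * StokesWave.GamInf γ) ∧
        StokesWave.riccati γ lam ((π / L) ^ 2) ε 0 = g := fun ε => by
    by_cases hε : ε ∈ Ico (0 : ℝ) 1
    · obtain ⟨lam, h1, h2⟩ := StokesWave.exists_riccati_zero_eq hg hL hγ hΓ hbif hε.1 hε.2.le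
      exact ⟨lam, fun _ => ⟨h1, h2⟩⟩
    · exact ⟨0, fun h => absurd h hε⟩
  choose lam hlam using hex
  have h0mem : (0 : ℝ) ∈ Ico (0 : ℝ) 1 := ⟨le_rfl, one_pos⟩
  obtain ⟨hlam0, hval0⟩ := hlam 0 h0mem
  have hle : ∀ ε ∈ Ico (0 : ℝ) 1, lam ε ≤ lam 0 := fun ε hε => by
    by_contra! hlt
    obtain ⟨h1, h2⟩ := hlam ε hε
    have h3 := StokesWave.riccati_zero_strictMono_lam hγ hΓ hlam0.1 hlt hκ le_rfl
    have h4 := StokesWave.riccati_zero_mono_eps hγ hΓ h1.1 hκ le_rfl hε.1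
    linarith
  refine ⟨lam, fun ε hε => ?_, hle, ?_⟩
  · obtain ⟨hmem, hval⟩ := hlam ε hε
    have hsol := StokesWave.isEigenSolution_modeFun (α := α) hL hα₀ hα₁ hγ hΓ hmem.1 hε.1 hval
    have hpos := StokesWave.modeFun_pos γ (lam ε) ((π / L) ^ 2) ε
    refine ⟨hmem, fun μ hμ => ⟨?_, ?_⟩, StokesWave.modeFun γ (lam ε) ((π / L) ^ 2) ε,
      fun p _ => hpos p, ?_, hsol,
      fun φ hφ => hφ.eq_firstMode hL hγ hΓ hmem.1 hε.1 hval⟩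
    · rintro ⟨v, hv, hv'⟩
      have h1 := StokesWave.riccati_zero_eq_of_isEigenSolution hL hγ hΓ hμ.1 hε.1 hv hv'
      rcases lt_trichotomy μ (lam ε) with h | h | h
      · have := StokesWave.riccati_zero_strictMono_lam hγ hΓ hμ.1 h hκ hε.1
        linarith
      · exact h
      · have := StokesWave.riccati_zero_strictMono_lam hγ hΓ hmem.1 h hκ hε.1
        linarith
    · rintro rfl
      exact ⟨_, ⟨0, 0, le_rfl, by simpa [StokesWave.firstMode] using (hpos 0).ne'⟩, hsol⟩
    · obtain ⟨σ, hσ, h1⟩ :=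
        StokesWave.modeFun_le_exp hγ hΓ hmem.1 hκ.le hε.1 (by linarith [hε.1])
      exact ⟨1, σ, hσ, fun p hp => by rw [one_mul, abs_of_pos (hpos p)]; exact h1 p hp⟩
  · have hIio : ∀ᶠ ε in 𝓝[>] (0 : ℝ), ε ∈ Ico (0 : ℝ) 1 := by
      filter_upwards [Ioo_mem_nhdsGT one_pos] with ε hε using ⟨hε.1.le, hε.2⟩
    refine tendsto_order.2 ⟨fun x hx => ?_, fun x hx => ?_⟩
    -- at any `y < lam 0` the value of `w(0)` is below `g` for `ε = 0`, hence also for small `ε`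
    · obtain ⟨y, hy1, hy2⟩ := exists_between (max_lt hx hlam0.1)
      have hy : -2 * StokesWave.GamInf γ < y := (le_max_right _ _).trans_lt hy1
      have h1 := StokesWave.riccati_zero_strictMono_lam hγ hΓ hy hy2 hκ le_rfl
      rw [hval0] at h1
      filter_upwards [(StokesWave.tendsto_riccati_zero_eps hγ hΓ hy hκ).eventually
        (gt_mem_nhds h1), hIio] with ε hε hε'
      obtain ⟨h2, h3⟩ := hlam ε hε'
      refine ((le_max_left _ _).trans_lt hy1).trans ?_
      by_contra! hcon
      rcases hcon.eq_or_lt with h | h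
      · rw [h] at h3
        linarith
      · have := StokesWave.riccati_zero_strictMono_lam hγ hΓ h2.1 h hκ hε'.1
        linarith
    · filter_upwards [hIio] with ε hε using (hle ε hε).trans_lt hx
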